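/- Let $\mathbb K$ be a field of characteristic $0$, let $\Lambda$ be a free abelian group, and let $\mathcal L$ be a Lie algebra over $\mathbb K$ (possibly infinite-dimensional). **Root-graded Lie algebras.** Let $\mathfrak g\subseteq\mathcal L$ be a finite-dimensional simple subalgebra with a splitting Cartan subalgebra $\mathfrak h$, let $R\ni 0$ be the root system of $(\mathfrak g,\mathfrak h)$ and $R^\times=R\setminus\{0\}$; assume that $R$ is simply-laced of rank $\dim\mathfrak h\ge 2$. Put $\mathcal L_\alpha=\{x\in\mathcal L : [h,x]=\alpha(h)x \text{ for all } h\in\mathfrak h\}$. Assume that $\mathcal L$ is division $(R,\Lambda)$-graded, that is: * $\mathcal L=\bigoplus_{\alpha\in R}\mathcal L_\alpha$ and $\mathcal L_0=\sum_{\alpha\in R^\times}[\mathcal L_\alpha,\mathcal L_{-\alpha}]$; * $\mathcal L=\bigoplus_{\lambda\in\Lambda}\mathcal L^\lambda$ is a $\Lambda$-graded Lie algebra, $\mathfrak g\subseteq\mathcal L^0$, and $\{\lambda : \mathcal L^\lambda\ne 0\}$ generates $\Lambda$; * writing $\mathcal L_\alpha^\lambda=\mathcal L_\alpha\cap\mathcal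 L^\lambda$, for all $\alpha\in R^\times$, $\lambda\in\Lambda$ and $0\ne x\in\mathcal L_\alpha^\lambda$ there is $y\in\mathcal L_{-\alpha}^{-\lambda}$ with $[[x,y],z]=\langle\beta,\alpha^\vee\rangle z$ for all $\beta\in R$, $z\in\mathcal L_\beta$. Assume that $\mathcal L$ has a Chevalley involution $\tau$: an automorphism of the Lie algebra $\mathcal L$ with $\tau^2=\mathrm{id}$, $\tau(\mathfrak g)=\mathfrak g$, $\tau(\mathcal L^\lambda)=\mathcal L^{-\lambda}$ for all $\lambda\in\Lambda$, and $\tau(x)=-x$ for all $x\in\mathcal L^0_0$. **The coordinate algebra.** Let $e_\alpha\in\mathfrak g_\alpha$ ($\alpha\in R^\times$) be the root vectors of any Chevalley basis of $\mathfrak g$. Let $\mathcal N\subseteq \mathrm{GL}(\mathcal L)$ be the group generated by the maps $\exp(\mathrm{ad}\,te_\alpha)\exp(\mathrm{ad}(-t^{-1}e_{-\alpha}))\exp(\mathrm{ad}\,te_\alpha)$ with $\alpha\in R^\times$, $t\in\mathbb K^\times$. For $\alpha,\beta\in R^\times$ let $\theta_{\beta,\alpha}:\mathcal L_\alpha\to\mathcal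 L_\beta$ be $\epsilon^{-1}\eta|_{\mathcal L_\alpha}$, where $\eta\in\mathcal N$ is an element that maps $\mathcal L_\alpha$ to $\mathcal L_\beta$ with $\eta(e_\alpha)=\epsilon e_\beta$, $\epsilon\in\mathbb K^\times$ (this does not depend on $\eta$). Fix $\alpha\in R^\times$ and set $\mathcal A=\mathcal L_\alpha$, $\mathcal A^\lambda=\mathcal L_\alpha^\lambda$, and $e_\mu(a)=\theta_{\mu,\alpha}(a)$ for $a\in\mathcal A$, $\mu\in R^\times$. Fix an $A_2$-pair $(\beta,\gamma)$, i.e. linearly independent roots such that $(\mathbb Z\beta+\mathbb Z\gamma)\cap R$ is a root system of type $A_2$ with base $\{\beta,\gamma\}$. The coordinate algebra of $\mathcal L$ is $\mathcal A$ with the multiplication determined by $$[e_\beta(a),e_\gamma(b)]=N\,e_{\beta+\gamma}(ab)\qquad(a,b\in\mathcal A),$$ where $[e_\beta,e_\gamma]=N e_{\beta+\gamma}$, $N\in\mathbb K^\times$. **Proposition.** For every such choice of the Chevalley basis, $\alpha$ and $(\beta,\gamma)$, the coordinate algebra $\mathcal A=\bigoplus_{\lambda\in\Lambda}\mathcal A^\lambda$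 is a $\Lambda$-graded algebra, and it admits a pre-Chevalley (anti)-involution: there is a $\mathbb K$-linear map $\bar{\ }:\mathcal A\to\mathcal A$ with $\overline{ab}=\bar b\,\bar a$ and $\overline{\bar a}=a$ for all $a,b\in\mathcal A$, and $\overline{\mathcal A^\lambda}=\mathcal A^{-\lambda}$ for all $\lambda\in\Lambda$. -/

import Mathlib

open LieAlgebra LieModule

namespace RootGraded

/-! ### Graded algebras and anti-involutions -/

section GradedAlgebra

variable {K A Λ : Type*} [Field K] [AddCommGroup A] [Module K A] [AddCommGroup Λ]

/-- The (not necessarily associative) algebra with underlying space `A` and multiplication `m`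
is graded by `Λ`, with homogeneous components `𝒜 l`. -/
structure IsGradedAlgebra (m : A →ₗ[K] A →ₗ[K] A) (𝒜 : Λ → Submodule K A) : Prop where
  independent : iSupIndep 𝒜
  iSup_eq_top : (⨆ l, 𝒜 l) = ⊤
  mul_mem : ∀ l k : Λ, ∀ a ∈ 𝒜 l, ∀ b ∈ 𝒜 k, m a b ∈ 𝒜 (l + k)

/-- An (anti)-involution of the algebra `(A, m)`: a linear map that reverses products and squares
to the identity. -/
structure IsAntiInvolution (m : A →ₗ[K] A →ₗ[K] A) (bar : A →ₗ[K] A) : Prop where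
  map_mul : ∀ a b : A, bar (m a b) = m (bar b) (bar a)
  bar_bar : ∀ a : A, bar (bar a) = a

/-- A pre-Chevalley (anti)-involution of a `Λ`-graded algebra: an (anti)-involution that maps
the component of degree `l` onto the component of degree `-l`. -/
structure IsPreChevalley (m : A →ₗ[K] A →ₗ[K] A) (𝒜 : Λ → Submodule K A) (bar : A →ₗ[K] A) : Prop
    extends IsAntiInvolution m bar where
  map_component : ∀ l : Λ, (𝒜 l).map bar = 𝒜 (-l)

end GradedAlgebra

/-! ### Root-graded Lie algebras -/

section Weights

variable {K L : Type*} [Field K] [LieRing L] [LieAlgebra K L]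
  {g : LieSubalgebra K L} (H : LieSubalgebra K g)

/-- The simultaneous eigenspace `L_χ = {x ∈ L | [h, x] = χ(h) x for all h ∈ H}` of a
subalgebra `H` of a subalgebra `g` of `L`. -/
def component (χ : H → K) : Submodule K L where
  carrier := {x | ∀ h : H, ⁅((h : g) : L), x⁆ = χ h • x}
  add_mem' := by
    intro x y hx hy h
    rw [lie_add, hx h, hy h, smul_add]
  zero_mem' := by
    intro h
    rw [lie_zero, smul_zero]
  smul_mem' := by
    intro c x hx h
    rw [lie_smul, hx h, smul_comm]

/-- `L_χ ∩ L^l` for a family `ℒ l = L^l` of subspaces of `L`. -/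
def bicomponent {Λ : Type*} (ℒ : Λ → Submodule K L) (χ : H → K) (l : Λ) : Submodule K L :=
  component H χ ⊓ ℒ l

theorem lie_mem_component {χ ψ ω : H → K} (hω : ω = χ + ψ) {x y : L}
    (hx : x ∈ component H χ) (hy : y ∈ component H ψ) : ⁅x, y⁆ ∈ component H ω := by
  intro h
  rw [leibniz_lie, hx h, hy h, smul_lie, lie_smul, hω, Pi.add_apply, add_smul]

end Weights

section Gradings

variable {K L : Type*} [Field K] [CharZero K] [LieRing L] [LieAlgebra K L]
  {g : LieSubalgebra K L} [FiniteDimensional K g] [LieAlgebra.IsSimple K g]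
  (H : LieSubalgebra K g) [H.IsCartanSubalgebra] [IsTriangularizable K H g]

/-- `L` is graded by the root system `R` of `(g, H)`. The type `Weight K H g` consists of the
elements of `R`, including `0`, and the finite set `H.root` consists of the nonzero ones. -/
structure IsRootGraded : Prop where
  independent : iSupIndep fun α : Weight K H g => component H (α : H → K)
  iSup_eq_top : (⨆ α : Weight K H g, component H (α : H → K)) = ⊤
  zero_component : component H (0 : H → K) =
    ⨆ α ∈ H.root, Submodule.span K
      {z | ∃ x ∈ component H (α : H → K), ∃ y ∈ component H (-(α : H → K)), ⁅x, y⁆ = z}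

/-- The root system of `(g, H)` is simply-laced: Cartan integers of non-proportional roots are
`0`, `1` or `-1`. (It is irreducible and reduced as `g` is simple, and its rank is `dim H`.) -/
def IsSimplyLaced : Prop :=
  ∀ α β : H.root, (α : Weight K H g) ≠ β → (α : Weight K H g) ≠ -β →
    (IsKilling.rootSystem H).pairing α β = 0 ∨ (IsKilling.rootSystem H).pairing α β = 1 ∨
      (IsKilling.rootSystem H).pairing α β = -1

variable {Λ : Type*} [AddCommGroup Λ]

/-- `L` is `(R, Λ)`-graded: it is `R`-graded, and `ℒ` is a compatible `Λ`-grading. -/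
structure IsRootLatticeGraded (ℒ : Λ → Submodule K L) : Prop extends IsRootGraded H where
  grading_independent : iSupIndep ℒ
  grading_iSup_eq_top : (⨆ l, ℒ l) = ⊤
  lie_mem : ∀ l k : Λ, ∀ x ∈ ℒ l, ∀ y ∈ ℒ k, ⁅x, y⁆ ∈ ℒ (l + k)
  le_zero : g.toSubmodule ≤ ℒ 0
  closure_support : AddSubgroup.closure {l : Λ | ℒ l ≠ ⊥} = ⊤

/-- `L` is division `(R, Λ)`-graded. -/
structure IsDivisionGraded (ℒ : Λ → Submodule K L) : Prop extends IsRootLatticeGraded H ℒ where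
  exists_inverse : ∀ α ∈ H.root, ∀ l : Λ, ∀ x ∈ bicomponent H ℒ (α : H → K) l, x ≠ 0 →
    ∃ y ∈ bicomponent H ℒ (-(α : H → K)) (-l),
      ∀ β : Weight K H g, ∀ z ∈ component H (β : H → K),
        ⁅⁅x, y⁆, z⁆ = β (IsKilling.coroot α) • z

/-- `τ` is a Chevalley involution of the `(R, Λ)`-graded Lie algebra `(L, g, H)`. -/
structure IsChevalleyInvolution (ℒ : Λ → Submodule K L) (τ : L ≃ₗ⁅K⁆ L) : Prop where
  apply_apply : ∀ x : L, τ (τ x) = x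
  map_subalgebra : g.map (τ : L →ₗ⁅K⁆ L) = g
  map_grading : ∀ l : Λ, (ℒ l).map (τ : L →ₗ[K] L) = ℒ (-l)
  apply_eq_neg : ∀ x ∈ bicomponent H ℒ (0 : H → K) 0, τ x = -x

end Gradings

/-! ### Chevalley bases and the coordinate algebra -/

section Coordinates

variable {K L : Type*} [Field K] [CharZero K] [LieRing L] [LieAlgebra K L]
  {g : LieSubalgebra K L} [FiniteDimensional K g] [LieAlgebra.IsSimple K g]
  {H : LieSubalgebra K g} [H.IsCartanSubalgebra] [IsTriangularizable K H g]

/-- The vectors `e α` (`α` a nonzero root) are the root vectors of a Chevalley basis of `g`: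
`e α ∈ g_α`, `[e α, e (-α)]` is the coroot of `α`, and if `[e α, e β] = c e (α + β)` then
`[e (-α), e (-β)] = -c e (-α - β)`. (The remaining members of the basis are the coroots of the
simple roots of a base. The value of `e` at the weight `0` is irrelevant.) -/
structure IsChevalleyBasis (e : Weight K H g → g) : Prop where
  mem_rootSpace : ∀ α ∈ H.root, e α ∈ rootSpace H (α : H → K)
  lie_neg : ∀ α ∈ H.root, ⁅e α, e (-α)⁆ = ((IsKilling.coroot α : H) : g)
  lie_add : ∀ α ∈ H.root, ∀ β ∈ H.root, ∀ δ ∈ H.root, (δ : H → K) = α + β →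
    ∃ c : K, ⁅e α, e β⁆ = c • e δ ∧ ⁅e (-α), e (-β)⁆ = -c • e (-δ)

/-- The exponential `∑ fⁿ / n!` of a nilpotent endomorphism `f` (a finite sum). -/
noncomputable def expNilpotent (f : Module.End K L) : Module.End K L :=
  ∑ n ∈ Finset.range (nilpotencyClass f), ((n.factorial : K)⁻¹) • f ^ n

/-- `Ad η_α(t) = exp(ad t e_α) exp(ad (-t⁻¹ e_{-α})) exp(ad t e_α)`, acting on `L`. -/
noncomputable def adEta (e : Weight K H g → g) (α : Weight K H g) (t : K) : Module.End K L :=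
  expNilpotent (LieAlgebra.ad K L (t • (e α : L))) *
    expNilpotent (LieAlgebra.ad K L (-t⁻¹ • (e (-α) : L))) *
      expNilpotent (LieAlgebra.ad K L (t • (e α : L)))

/-- The image under `Ad` of the group `𝒩` generated by the elements `η_α(t)`, where `α` is a
nonzero root and `t ∈ Kˣ`. -/
def adN (e : Weight K H g → g) : Subgroup (L ≃ₗ[K] L) :=
  Subgroup.closure
    {u | ∃ α ∈ H.root, ∃ t : K, t ≠ 0 ∧ (u : L →ₗ[K] L) = adEta e α t}

open Classical in
/-- The transfer map `θ_{β, α} : L_α → L_β`, `θ_{β, α} = ε⁻¹ Ad(η)`, where `η ∈ 𝒩` is chosen such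
that it maps `L_α` to `L_β`, and `Ad(η) e_α = ε e_β` with `ε ≠ 0`. (Such `η` are those
representing the Weyl group elements that map `α` to `β`; the map does not depend on the choice of
`η`.) -/
noncomputable def theta (e : Weight K H g → g) (β α : Weight K H g) :
    component H (α : H → K) →ₗ[K] component H (β : H → K) :=
  if h : ∃ p : (L ≃ₗ[K] L) × K, p.1 ∈ adN e ∧ p.2 ≠ 0 ∧ p.1 (e α : L) = p.2 • (e β : L) ∧
      ∀ x ∈ component H (α : H → K), (p.1 : L →ₗ[K] L) x ∈ component H (β : H → K)
  then h.choose.2⁻¹ • (h.choose.1 : L →ₗ[K] L).restrict h.choose_spec.2.2.2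
  else 0

/-- `(β, γ)` is an `A₂`-pair: `β` and `γ` are linearly independent roots, and the roots in
`ℤβ + ℤγ` form a root system of type `A₂` with base `{β, γ}`. -/
structure IsA2Pair (β γ : Weight K H g) : Prop where
  left_mem : β ∈ H.root
  right_mem : γ ∈ H.root
  linearIndependent : LinearIndependent K ![(β : H → K), (γ : H → K)]
  roots_eq : {χ : H → K | (∃ δ ∈ H.root, (δ : H → K) = χ) ∧
      ∃ m n : ℤ, χ = m • (β : H → K) + n • (γ : H → K)} =
    {(β : H → K), (γ : H → K), (β : H → K) + γ, -(β : H → K), -(γ : H → K), -((β : H → K) + γ)}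

open Classical in
/-- The structure constant `N` with `[e_β, e_γ] = N e_δ`, where `δ = β + γ`. -/
noncomputable def structureConstant (e : Weight K H g → g) (β γ δ : Weight K H g) : K :=
  if h : ∃ c : K, ⁅e β, e γ⁆ = c • e δ then h.choose else 0

/-- The multiplication `(a, b) ↦ ab` of the coordinate algebra `𝒜`, realized on the vector space
`L_α`, with respect to the pair `(β, γ)` with `δ = β + γ`. With `e_μ(a) = θ_{μ, α}(a)`, it is given
by `[e_β(a), e_γ(b)] = N e_δ(ab)`, where `[e_β, e_γ] = N e_δ`; that is,
`ab = N⁻¹ θ_{α, δ} [θ_{β, α}(a), θ_{γ, α}(b)]`, as `θ_{α, δ}` is the inverse of `θ_{δ, α}`. -/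
noncomputable def coordinateMul (e : Weight K H g → g) (α β γ δ : Weight K H g)
    (hδ : (δ : H → K) = β + γ) :
    component H (α : H → K) →ₗ[K] component H (α : H → K) →ₗ[K] component H (α : H → K) :=
  (structureConstant e β γ δ)⁻¹ • LinearMap.mk₂ K
    (fun a b => theta e α δ
      ⟨⁅(theta e β α a : L), (theta e γ α b : L)⁆,
        lie_mem_component H hδ (theta e β α a).2 (theta e γ α b).2⟩)
    (by
      intro a a' b
      rw [← map_add]
      congr 1
      ext
      simp)
    (by
      intro c a b
      rw [← map_smul]
      congr 1
      ext
      simp)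
    (by
      intro a b b'
      rw [← map_add]
      congr 1
      ext
      simp)
    (by
      intro c a b
      rw [← map_smul]
      congr 1
      ext
      simp)

/-- The homogeneous component `𝒜^l = L_α^l` of the coordinate algebra `𝒜 = L_α`. -/
def coordinateComponent {Λ : Type*} (ℒ : Λ → Submodule K L) (α : Weight K H g) (l : Λ) :
    Submodule K (component H (α : H → K)) :=
  (bicomponent H ℒ (α : H → K) l).submoduleOf (component H (α : H → K))

end Coordinates

end RootGraded

/-!
The vectors of nonzero weight `α` in `L` are parametrized by the `g`-module homomorphisms `g → L`
from the adjoint module, by evaluation at `e α`: in `g × L` the submodule generated by `(e α, x)` is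
the graph of such a homomorphism, because its weight space for `α` is a line and the Casimir element
of `g` rules out a trivial part in the kernel of the projection to `g`. As `𝒩` commutes with
homomorphisms, `θ_{β, α}` moves the point of evaluation from `e α` to `e β`. In these terms the
product `χ` of `φ` and `ψ` is given by `[φ(e_β), ψ(e_γ)] = N χ(e_δ)`, independently of `α`.

The involution is the conjugation `φ ↦ τ ∘ φ ∘ τ`. Applying `(ad e_{-δ})²` to the product formula
turns the right factor into one of weight `-β` and the left one into one of weight `-γ`; a further
application of `τ` gives the product formula for the conjugates in the opposite order, up to a
scalar that does not depend on `φ` and `ψ`, and which is right for the inclusion `g → L`.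
-/

namespace RootGraded

/-! ### Simply-laced root systems -/

section RootPairing

variable {ι R M N : Type*} [CommRing R] [AddCommGroup M] [Module R M]
  [AddCommGroup N] [Module R N]

/-- A root pairing is simply laced if the Cartan integers of non-proportional roots are `0`, `1`
or `-1`. -/
def HasSimplyLacedRoots (P : RootPairing ι R M N) : Prop :=
  ∀ i j, i ≠ j → P.root i ≠ -P.root j →
    P.pairing i j = 0 ∨ P.pairing i j = 1 ∨ P.pairing i j = -1

variable {P : RootPairing ι R M N}

theorem forall_weylGroupToPerm {p : ι → Prop} (hp : ∀ j k, p k → p (P.reflectionPerm j k))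
    (w : P.weylGroup) {i : ι} (hi : p i) : p (P.weylGroupToPerm w i) := by
  obtain ⟨w, hw⟩ := w
  induction hw using RootPairing.weylGroup.induction generalizing i with
  | mem j => exact hp j i hi
  | one => exact hi
  | mul _ _ _ _ h₁ h₂ => exact h₁ (h₂ hi)

theorem exists_pairing_ne_zero [CharZero R] [P.IsIrreducible] {p : ι → Prop} {i : ι} (hi : p i)
    (hp : ∀ j k, p k → p (P.reflectionPerm j k)) (j : ι) : ∃ k, p k ∧ P.pairing k j ≠ 0 := by
  by_contra! h
  have hker : Submodule.span R (MulAction.orbit P.weylGroup (P.root i)) ≤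
      LinearMap.ker (P.coroot' j) := by
    rw [Submodule.span_le]
    rintro _ ⟨w, rfl⟩
    change P.coroot' j (w • P.root i) = 0
    rw [P.weylGroup_apply_root]
    exact h _ (forall_weylGroupToPerm hp w hi)
  rw [P.span_orbit_eq_top, top_le_iff, LinearMap.ker_eq_top] at hker
  simpa using LinearMap.congr_fun hker (P.root j)

variable [CharZero R] [IsDomain R] [Finite ι] [P.IsCrystallographic] [P.IsReduced]

theorem HasSimplyLacedRoots.pairing_comm (hP : HasSimplyLacedRoots P) {i j : ι}
    (hij : i ≠ j) (hneg : P.root i ≠ -P.root j) : P.pairing i j = P.pairing j i := by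
  have hmem := P.pairingIn_pairingIn_mem_set_of_isCrystal_of_isRed' i j (by simpa) hneg
  have hi := hP i j hij hneg
  have hj := hP j i hij.symm fun h => hneg (by rw [h, neg_neg])
  simp only [← P.algebraMap_pairingIn ℤ, algebraMap_int_eq, eq_intCast] at hi hj ⊢
  norm_cast at hi hj ⊢
  simp only [Set.mem_insert_iff, Prod.mk.injEq, Set.mem_singleton_iff] at hmem
  omega

theorem HasSimplyLacedRoots.reflectionPerm_induction [P.IsIrreducible]
    (hP : HasSimplyLacedRoots P) {p : ι → Prop} {i : ι} (hi : p i)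
    (hp : ∀ j k, p k → p (P.reflectionPerm j k)) (j : ι) : p j := by
  have of_root_eq_neg {l : ι} (hl : p l) (h : P.root l = -P.root j) : p j := by
    have : P.reflectionPerm l l = j := P.root.injective (by
      rw [P.root_reflectionPerm, P.reflection_apply_self, h, neg_neg])
    exact this ▸ hp l l hl
  obtain ⟨k, hk, hkj⟩ := exists_pairing_ne_zero hi hp j
  by_cases h : k = j
  · rwa [← h]
  by_cases hneg : P.root k = -P.root j
  · exact of_root_eq_neg hk hneg
  have hroot : P.root (P.reflectionPerm k (P.reflectionPerm j k)) = -P.pairing k j • P.root j := by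
    have hone : P.pairing k j * P.pairing k j = 1 := by
      rcases (hP k j h hneg).resolve_left hkj with hc | hc <;> simp [hc]
    simp only [P.root_reflectionPerm, P.reflection_apply_root, map_sub, map_smul, P.pairing_same]
    rw [← hP.pairing_comm h hneg]
    linear_combination (norm := module) hone • P.root k
  have hp' := hp k _ (hp j k hk)
  rcases (hP k j h hneg).resolve_left hkj with hc | hc
  · exact of_root_eq_neg hp' (by simpa [hc] using hroot)
  · rwa [P.root.injective (hroot.trans (by rw [hc, neg_neg, one_smul]))] at hp'

end RootPairing

/-! ### Weight-graded modules -/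

section WeightSpaces

variable {K 𝔤 : Type*} [Field K] [LieRing 𝔤] [LieAlgebra K 𝔤] {H : LieSubalgebra K 𝔤}
  {M N : Type*} [AddCommGroup M] [Module K M] [LieRingModule 𝔤 M] [LieModule K 𝔤 M]
  [AddCommGroup N] [Module K N] [LieRingModule 𝔤 N] [LieModule K 𝔤 N]

theorem mem_weightSpace_iff {χ : H → K} {m : M} :
    m ∈ weightSpace M χ ↔ ∀ h : H, ⁅(h : 𝔤), m⁆ = χ h • m :=
  mem_weightSpace χ m

theorem lie_mem_weightSpace {χ ψ ω : H → K} (hω : ω = χ + ψ) {y : 𝔤} {m : M}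
    (hy : y ∈ weightSpace 𝔤 χ) (hm : m ∈ weightSpace M ψ) : ⁅y, m⁆ ∈ weightSpace M ω := by
  rw [mem_weightSpace_iff] at *
  intro h
  rw [leibniz_lie, hy h, hm h, smul_lie, lie_smul, hω, Pi.add_apply, add_smul]

theorem toEnd_pow_mem_weightSpace {χ ψ : H → K} {y : 𝔤} {m : M} (hy : y ∈ weightSpace 𝔤 χ)
    (hm : m ∈ weightSpace M ψ) (n : ℕ) :
    (toEnd K 𝔤 M y ^ n) m ∈ weightSpace M (ψ + (n : K) • χ) := by
  induction n with
  | zero => simpa using hm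
  | succ n ih =>
    rw [pow_succ', Module.End.mul_apply]
    exact lie_mem_weightSpace (by push_cast; module) hy ih

theorem map_mem_weightSpace (φ : M →ₗ⁅K,𝔤⁆ N) {χ : H → K} {m : M} (hm : m ∈ weightSpace M χ) :
    φ m ∈ weightSpace N χ := by
  rw [mem_weightSpace_iff] at *
  intro h
  rw [← LieModuleHom.map_lie, hm h, map_smul]

variable [LieRing.IsNilpotent H]

variable (H M) in
theorem iSupIndep_weightSpace_fun : iSupIndep fun χ : H → K => weightSpace M χ :=
  (iSupIndep_genWeightSpace K H M).mono fun χ => weightSpace_le_genWeightSpace M χ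

variable (H M) in
/-- The module is the sum of its weight spaces for the weights of the adjoint module. -/
def IsWeightGraded : Prop := ⨆ ν : Weight K H 𝔤, weightSpace M (ν : H → K) = ⊤

theorem IsWeightGraded.mem_of_forall_weight (hM : IsWeightGraded H M) {U : Submodule K M}
    (hU : ∀ ν : Weight K H 𝔤, ∀ m ∈ weightSpace M (ν : H → K), m ∈ U) (m : M) : m ∈ U := by
  have htop : ⨆ ν : Weight K H 𝔤, (weightSpace M (ν : H → K)).toSubmodule = ⊤ := by
    rw [← LieSubmodule.iSup_toSubmodule, hM, LieSubmodule.top_toSubmodule]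
  have hle : (⊤ : Submodule K M) ≤ U := htop ▸ iSup_le hU
  exact hle trivial

theorem IsWeightGraded.eq_zero_of_forall_ne (hM : IsWeightGraded H M) {χ : H → K}
    (hχ : ∀ ν : Weight K H 𝔤, (ν : H → K) ≠ χ) {m : M} (hm : m ∈ weightSpace M χ) : m = 0 := by
  have htop : (⊤ : LieSubmodule K H M) ≤ ⨆ (ψ : H → K) (_ : ψ ≠ χ), weightSpace M ψ := by
    rw [← hM]
    exact iSup_le fun ν => le_iSup₂_of_le (ν : H → K) (hχ ν) le_rfl
  have hdisj := (iSupIndep_weightSpace_fun H M χ).mono_right htop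
  rw [disjoint_top] at hdisj
  simpa [hdisj] using hm

theorem IsWeightGraded.mem_weightSpace_zero (hM : IsWeightGraded H M) {φ : M →ₗ⁅K,𝔤⁆ N}
    (hφ : ∀ ν : Weight K H 𝔤, ν.IsNonZero → ∀ m ∈ weightSpace M (ν : H → K), φ m = 0 → m = 0)
    {m : M} (hm : φ m = 0) : m ∈ weightSpace M (0 : H → K) := by
  have hsum : m ∈ ⨆ ν : Weight K H 𝔤, (weightSpace M (ν : H → K)).toSubmodule := by
    rw [← LieSubmodule.iSup_toSubmodule, hM]
    trivial
  obtain ⟨f, hf, rfl⟩ := (Submodule.mem_iSup_iff_exists_finsupp _ _).1 hsum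
  have hindep : iSupIndep fun ν : Weight K H 𝔤 => (weightSpace N (ν : H → K)).toSubmodule :=
    LieSubmodule.iSupIndep_toSubmodule.2
      ((iSupIndep_weightSpace_fun H N).comp DFunLike.coe_injective)
  have hφf : ∀ ν ∈ f.support, φ (f ν) = 0 :=
    (iSupIndep_iff_finsetSum_eq_zero_imp_eq_zero _).1 hindep f.support _
      (fun ν _ => map_mem_weightSpace φ (hf ν)) (by rw [← map_sum]; exact hm)
  refine sum_mem fun ν hν => ?_
  by_cases h0 : ν.IsZero
  · exact h0.eq ▸ hf ν
  · rw [hφ ν h0 (f ν) (hf ν) (hφf ν hν)]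
    exact zero_mem _

end WeightSpaces

theorem mem_root_iff {K 𝔤 : Type*} [Field K] [LieRing 𝔤] [LieAlgebra K 𝔤] [FiniteDimensional K 𝔤]
    {H : LieSubalgebra K 𝔤} [H.IsCartanSubalgebra] {μ : Weight K H 𝔤} :
    μ ∈ H.root ↔ μ.IsNonZero := by
  simp

section Killing

variable {K 𝔤 : Type*} [Field K] [CharZero K] [LieRing 𝔤] [LieAlgebra K 𝔤]
  [FiniteDimensional K 𝔤] [IsKilling K 𝔤]
  {H : LieSubalgebra K 𝔤} [H.IsCartanSubalgebra] [IsTriangularizable K H 𝔤]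

theorem weightSpace_eq_rootSpace (χ : H → K) : weightSpace 𝔤 χ = rootSpace H χ :=
  le_antisymm (weightSpace_le_genWeightSpace 𝔤 χ) fun _ hx =>
    mem_weightSpace_iff.2 fun h => IsKilling.lie_eq_smul_of_mem_rootSpace hx h

theorem mem_of_mem_weightSpace_zero {x : 𝔤} (hx : x ∈ weightSpace 𝔤 (0 : H → K)) : x ∈ H := by
  rwa [weightSpace_eq_rootSpace, rootSpace_zero_eq K 𝔤 H, LieSubalgebra.mem_toLieSubmodule] at hx

theorem apply_coroot_neg (μ ν : Weight K H 𝔤) :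
    μ (IsKilling.coroot (-ν)) = -μ (IsKilling.coroot ν) := by
  rw [IsKilling.coroot_neg, ← Weight.toLinear_apply, map_neg, Weight.toLinear_apply]

variable (H) in
theorem isWeightGraded_adjoint : IsWeightGraded H 𝔤 := by
  simpa only [IsWeightGraded, weightSpace_eq_rootSpace] using iSup_genWeightSpace_eq_top' K H 𝔤

theorem lie_mem_of_forall_weight {M : Type*} [AddCommGroup M] [Module K M] [LieRingModule 𝔤 M]
    [LieModule K 𝔤 M] {N : Submodule K M} {m : M}
    (h : ∀ μ : Weight K H 𝔤, ∀ y ∈ weightSpace 𝔤 (μ : H → K), ⁅y, m⁆ ∈ N) (y : 𝔤) :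
    ⁅y, m⁆ ∈ N :=
  (isWeightGraded_adjoint H).mem_of_forall_weight
    (U := N.comap ((toEnd K 𝔤 M : 𝔤 →ₗ[K] Module.End K M).flip m)) h y

theorem HasSimplyLacedRoots.apply_coroot (hS : HasSimplyLacedRoots (IsKilling.rootSystem H))
    (μ : Weight K H 𝔤) {ν : Weight K H 𝔤} (hν : ν.IsNonZero) :
    μ (IsKilling.coroot ν) = 0 ∨ μ (IsKilling.coroot ν) = 1 ∨ μ (IsKilling.coroot ν) = -1 ∨
      (μ = ν ∧ μ (IsKilling.coroot ν) = 2) ∨ (μ = -ν ∧ μ (IsKilling.coroot ν) = -2) := by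
  by_cases hμ : μ.IsZero
  · exact .inl (by rw [hμ.eq]; rfl)
  by_cases hself : μ = ν
  · subst hself
    simp [IsKilling.root_apply_coroot hν]
  by_cases hneg : μ = -ν
  · subst hneg
    simp [IsKilling.root_apply_coroot hν]
  have := hS ⟨μ, by simpa using hμ⟩ ⟨ν, by simpa using hν⟩ (by simpa using hself) fun h =>
    hneg <| Weight.ext fun x => by simpa using LinearMap.congr_fun h x
  simp only [IsKilling.rootSystem_pairing_apply] at this
  tauto

theorem HasSimplyLacedRoots.ne_of_apply_coroot
    (hS : HasSimplyLacedRoots (IsKilling.rootSystem H)) {χ : H → K}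
    {ν : Weight K H 𝔤} (hν : ν.IsNonZero) {n : ℕ}
    (hχ : χ (IsKilling.coroot ν) = n + 2) (hne : χ ≠ ν) (μ : Weight K H 𝔤) :
    (μ : H → K) ≠ χ := by
  rintro rfl
  have key (k : ℕ) (hk : 0 < k) : (n : K) + k ≠ 0 := by norm_cast; omega
  rcases hS.apply_coroot μ hν with h | h | h | ⟨rfl, -⟩ | ⟨-, h⟩
  · exact key 2 two_pos (by linear_combination h - hχ)
  · exact key 1 one_pos (by linear_combination h - hχ)
  · exact key 3 three_pos (by linear_combination h - hχ)
  · exact hne rfl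
  · exact key 4 four_pos (by linear_combination h - hχ)

theorem HasSimplyLacedRoots.le_two_of_apply_coroot
    (hS : HasSimplyLacedRoots (IsKilling.rootSystem H)) {μ ν : Weight K H 𝔤} (hν : ν.IsNonZero)
    {n : ℕ} (hn : μ (IsKilling.coroot ν) = n) : n ≤ 2 := by
  by_contra! h
  obtain ⟨k, rfl⟩ := Nat.exists_eq_add_of_lt h
  refine hS.ne_of_apply_coroot hν (χ := μ) (n := k + 1) ?_ (fun hμν => ?_) μ rfl
  · rw [hn]
    push_cast
    ring
  · rw [hμν, IsKilling.root_apply_coroot hν] at hn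
    norm_cast at hn
    omega

theorem HasSimplyLacedRoots.apply_coroot_add (hS : HasSimplyLacedRoots (IsKilling.rootSystem H))
    {β γ δ : Weight K H 𝔤} (hβ : β.IsNonZero) (hγ : γ.IsNonZero) (hδ : δ.IsNonZero)
    (hadd : (δ : H → K) = β + γ) : β (IsKilling.coroot δ) = 1 := by
  have hsum : β (IsKilling.coroot δ) + γ (IsKilling.coroot δ) = 2 := by
    rw [← IsKilling.root_apply_coroot hδ, hadd, Pi.add_apply]
  have hγδ (n : ℕ) : γ (IsKilling.coroot δ) ≠ n + 2 := fun h =>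
    hS.ne_of_apply_coroot hδ h (by simpa [hadd] using hβ) γ rfl
  rcases hS.apply_coroot β hδ with h | h | h | ⟨rfl, -⟩ | ⟨-, h⟩
  · exact absurd (by linear_combination hsum - h) (hγδ 0)
  · exact h
  · exact absurd (by linear_combination hsum - h) (hγδ 1)
  · exact absurd (left_eq_add.1 hadd) hγ
  · exact absurd (by linear_combination hsum - h) (hγδ 2)

theorem HasSimplyLacedRoots.apply_coroot_of_add
    (hS : HasSimplyLacedRoots (IsKilling.rootSystem H))
    {β γ δ : Weight K H 𝔤} (hβ : β.IsNonZero) (hγ : γ.IsNonZero) (hδ : δ.IsNonZero)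
    (hadd : (δ : H → K) = β + γ) : γ (IsKilling.coroot β) = -1 := by
  have hβδ := hS.apply_coroot_add hβ hγ hδ hadd
  have hne : δ ≠ β := by
    rintro rfl
    exact hγ (left_eq_add.1 hadd)
  have hneg : (δ : H → K) ≠ -β := fun h => by
    have := congr_fun h (IsKilling.coroot δ)
    rw [Pi.neg_apply, hβδ, IsKilling.root_apply_coroot hδ] at this
    norm_num [eq_neg_iff_add_eq_zero] at this
  have hδβ : δ (IsKilling.coroot β) = 1 := by
    rw [← hβδ]
    simpa only [IsKilling.rootSystem_pairing_apply] using
      hS.pairing_comm (i := ⟨δ, mem_root_iff.2 hδ⟩) (j := ⟨β, mem_root_iff.2 hβ⟩)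
        (fun h => hne (congr_arg Subtype.val h)) fun h => hneg (congr_arg DFunLike.coe h)
  rw [hadd, Pi.add_apply, IsKilling.root_apply_coroot hβ] at hδβ
  linear_combination hδβ

theorem HasSimplyLacedRoots.root_induction [LieAlgebra.IsSimple K 𝔤]
    (hS : HasSimplyLacedRoots (IsKilling.rootSystem H))
    {p : Weight K H 𝔤 → Prop} {α β : Weight K H 𝔤} (hα : α.IsNonZero) (hβ : β.IsNonZero)
    (hp : ∀ μ ν ω : Weight K H 𝔤, μ.IsNonZero → ν.IsNonZero → ω.IsNonZero → ∀ n : ℕ,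
      μ (IsKilling.coroot ν) = n → (ω : H → K) = μ - (n : K) • (ν : H → K) → p μ → p ω)
    (h : p α) : p β := by
  refine hS.reflectionPerm_induction (p := fun i => p i) (i := ⟨α, mem_root_iff.2 hα⟩) h
    (fun i j hj => ?_) ⟨β, mem_root_iff.2 hβ⟩
  have hi := mem_root_iff.1 i.2
  have hk := mem_root_iff.1 ((IsKilling.rootSystem H).reflectionPerm i j).2
  have hval := (IsKilling.rootSystem H).algebraMap_pairingIn ℤ j i
  rw [IsKilling.rootSystem_pairing_apply, algebraMap_int_eq, eq_intCast] at hval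
  have hω : (((IsKilling.rootSystem H).reflectionPerm i j).1 : H → K) =
      j.1 - j.1 (IsKilling.coroot i) • (i.1 : H → K) := by
    funext x
    have := LinearMap.congr_fun ((IsKilling.rootSystem H).root_reflectionPerm i j) x
    rw [RootPairing.reflection_apply_root, IsKilling.rootSystem_pairing_apply] at this
    exact this
  obtain ⟨n, hn | hn⟩ := Int.eq_nat_or_neg ((IsKilling.rootSystem H).pairingIn ℤ j i)
  all_goals rw [hn] at hval; push_cast at hval
  · exact hp j i _ (mem_root_iff.1 j.2) hi hk n hval.symm (by rw [hω, hval]) hj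
  · refine hp j (-i) _ (mem_root_iff.1 j.2) (Weight.IsNonZero.neg hi) hk n ?_ ?_ hj
    · rw [apply_coroot_neg, ← hval, neg_neg]
    · rw [hω, ← hval, Weight.coe_neg, smul_neg, neg_smul]

end Killing

/-! ### The Casimir endomorphism -/

section Casimir

variable {K 𝔤 : Type*} [Field K] [LieRing 𝔤] [LieAlgebra K 𝔤] [FiniteDimensional K 𝔤]
  [IsKilling K 𝔤]

variable (K 𝔤) in
/-- The basis of `𝔤` dual to `Module.finBasis K 𝔤` with respect to the Killing form. -/
noncomputable def killingDualBasis : Module.Basis (Fin (Module.finrank K 𝔤)) K 𝔤 :=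
  LinearMap.BilinForm.dualBasis (killingForm K 𝔤) (IsKilling.killingForm_nondegenerate K 𝔤)
    (Module.finBasis K 𝔤)

variable (K 𝔤) in
/-- The action on a `𝔤`-module of the Casimir element of the Killing form. -/
noncomputable def casimir (M : Type*) [AddCommGroup M] [Module K M] [LieRingModule 𝔤 M]
    [LieModule K 𝔤 M] : Module.End K M :=
  ∑ i, toEnd K 𝔤 M (Module.finBasis K 𝔤 i) * toEnd K 𝔤 M (killingDualBasis K 𝔤 i)

variable {M N : Type*} [AddCommGroup M] [Module K M] [LieRingModule 𝔤 M] [LieModule K 𝔤 M]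
  [AddCommGroup N] [Module K N] [LieRingModule 𝔤 N] [LieModule K 𝔤 N]

theorem casimir_apply (m : M) : casimir K 𝔤 M m =
    ∑ i, ⁅Module.finBasis K 𝔤 i, ⁅killingDualBasis K 𝔤 i, m⁆⁆ := by
  simp [casimir]

theorem map_casimir (φ : M →ₗ⁅K,𝔤⁆ N) (m : M) : φ (casimir K 𝔤 M m) = casimir K 𝔤 N (φ m) := by
  simp only [casimir_apply, map_sum, LieModuleHom.map_lie]

theorem killingDualBasis_repr (x : 𝔤) (i) :
    (killingDualBasis K 𝔤).repr x i = killingForm K 𝔤 x (Module.finBasis K 𝔤 i) :=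
  LinearMap.BilinForm.dualBasis_repr_apply ..

theorem finBasis_repr (x : 𝔤) (i) :
    (Module.finBasis K 𝔤).repr x i = killingForm K 𝔤 x (killingDualBasis K 𝔤 i) := by
  rw [← LinearMap.BilinForm.dualBasis_repr_apply (IsKilling.killingForm_nondegenerate K 𝔤),
    killingDualBasis, LinearMap.BilinForm.dualBasis_dualBasis _ ⟨traceForm_comm K 𝔤 𝔤⟩]

theorem casimir_lie (y : 𝔤) (m : M) : casimir K 𝔤 M ⁅y, m⁆ = ⁅y, casimir K 𝔤 M m⁆ := by
  have hdual (i) : ⁅Module.finBasis K 𝔤 i, ⁅⁅killingDualBasis K 𝔤 i, y⁆, m⁆⁆ =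
      ∑ j, killingForm K 𝔤 ⁅killingDualBasis K 𝔤 i, y⁆ (Module.finBasis K 𝔤 j) •
        ⁅Module.finBasis K 𝔤 i, ⁅killingDualBasis K 𝔤 j, m⁆⁆ := by
    conv_lhs => rw [← (killingDualBasis K 𝔤).sum_repr ⁅killingDualBasis K 𝔤 i, y⁆]
    simp only [killingDualBasis_repr, sum_lie, lie_sum, smul_lie, lie_smul]
  have hbasis (i) : ⁅⁅Module.finBasis K 𝔤 i, y⁆, ⁅killingDualBasis K 𝔤 i, m⁆⁆ =
      ∑ j, killingForm K 𝔤 ⁅Module.finBasis K 𝔤 i, y⁆ (killingDualBasis K 𝔤 j) •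
        ⁅Module.finBasis K 𝔤 j, ⁅killingDualBasis K 𝔤 i, m⁆⁆ := by
    conv_lhs => rw [← (Module.finBasis K 𝔤).sum_repr ⁅Module.finBasis K 𝔤 i, y⁆]
    simp only [finBasis_repr, sum_lie, smul_lie]
  have hcancel : ∑ i, ⁅Module.finBasis K 𝔤 i, ⁅⁅killingDualBasis K 𝔤 i, y⁆, m⁆⁆ +
      ∑ i, ⁅⁅Module.finBasis K 𝔤 i, y⁆, ⁅killingDualBasis K 𝔤 i, m⁆⁆ = 0 := by
    simp only [hdual, hbasis]
    rw [add_comm, Finset.sum_comm, ← Finset.sum_add_distrib]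
    refine Finset.sum_eq_zero fun i _ => ?_
    rw [← Finset.sum_add_distrib]
    refine Finset.sum_eq_zero fun j _ => ?_
    rw [← add_smul, killingForm, traceForm_apply_lie_apply, ← lie_skew, map_neg,
      traceForm_comm, neg_add_cancel, zero_smul]
  rw [← sub_eq_zero, ← hcancel, casimir_apply, casimir_apply, lie_sum, ← Finset.sum_sub_distrib,
    ← Finset.sum_add_distrib]
  refine Finset.sum_congr rfl fun i _ => ?_
  rw [leibniz_lie (killingDualBasis K 𝔤 i) y, lie_add, leibniz_lie (Module.finBasis K 𝔤 i) y]
  abel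

theorem casimir_adjoint (x : 𝔤) : casimir K 𝔤 𝔤 x = x := by
  suffices h : ∀ y, killingForm K 𝔤 (casimir K 𝔤 𝔤 x) y = killingForm K 𝔤 x y from
    LinearMap.ker_eq_bot.1 (IsKilling.killingForm_nondegenerate K 𝔤).ker_eq_bot (LinearMap.ext h)
  intro y
  calc killingForm K 𝔤 (casimir K 𝔤 𝔤 x) y
      = ∑ i, killingForm K 𝔤 ⁅y, ⁅x, killingDualBasis K 𝔤 i⁆⁆ (Module.finBasis K 𝔤 i) := by
        rw [casimir_apply, map_sum, LinearMap.sum_apply]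
        refine Finset.sum_congr rfl fun i _ => ?_
        rw [killingForm, traceForm_apply_lie_apply, traceForm_comm, ← lie_skew y, ← lie_skew x,
          neg_lie, neg_neg]
    _ = LinearMap.trace K 𝔤 (ad K 𝔤 y * ad K 𝔤 x) := by
        rw [LinearMap.trace_eq_matrix_trace K (killingDualBasis K 𝔤), Matrix.trace]
        refine Finset.sum_congr rfl fun i _ => ?_
        rw [Matrix.diag_apply, LinearMap.toMatrix_apply, killingDualBasis_repr]
        rfl
    _ = killingForm K 𝔤 x y := LinearMap.trace_mul_comm ..

end Casimir

/-! ### Homomorphisms from the adjoint module -/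

section CyclicSubmodule

variable {K 𝔤 : Type*} [CommRing K] [LieRing 𝔤] [LieAlgebra K 𝔤]
  {M : Type*} [AddCommGroup M] [Module K M] [LieRingModule 𝔤 M] [LieModule K 𝔤 M]

theorem lieSpan_singleton_le {w : M} {Y : Set 𝔤} {U : Submodule K M}
    (hY : ∀ p : 𝔤, ⁅p, w⁆ ∈ Submodule.span K (insert w ((⁅·, w⁆) '' Y))) (hw : w ∈ U)
    (hU : ∀ y ∈ Y, ∀ m ∈ U, ⁅y, m⁆ ∈ U) : (LieSubmodule.lieSpan K 𝔤 {w}).toSubmodule ≤ U := by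
  -- `sInf S` is the closure of `w` under `Y`. As the vectors all of whose translates by `𝔤` stay in
  -- this closure are again stable under `Y`, the closure is a Lie submodule.
  let S : Set (Submodule K M) := {V | w ∈ V ∧ ∀ y ∈ Y, ∀ m ∈ V, ⁅y, m⁆ ∈ V}
  have hwS : w ∈ sInf S := Submodule.mem_sInf.2 fun V hV => hV.1
  have hYS : ∀ y ∈ Y, ∀ m ∈ sInf S, ⁅y, m⁆ ∈ sInf S := fun y hy m hm =>
    Submodule.mem_sInf.2 fun V hV => hV.2 y hy m (Submodule.mem_sInf.1 hm V hV)
  let V : Submodule K M := sInf S ⊓ ⨅ p : 𝔤, (sInf S).comap (toEnd K 𝔤 M p : M →ₗ[K] M)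
  have mem_V {m : M} : m ∈ V ↔ m ∈ sInf S ∧ ∀ p : 𝔤, ⁅p, m⁆ ∈ sInf S := by
    simp only [V, Submodule.mem_inf, Submodule.mem_iInf, Submodule.mem_comap, toEnd_apply_apply]
  have hV : V ∈ S := by
    refine ⟨mem_V.2 ⟨hwS, fun p => Submodule.span_le.2 ?_ (hY p)⟩, fun y hy m hm => ?_⟩
    · rintro _ (rfl | ⟨y, hy, rfl⟩)
      exacts [hwS, hYS y hy w hwS]
    · obtain ⟨hm, hpm⟩ := mem_V.1 hm
      refine mem_V.2 ⟨hYS y hy m hm, fun p => ?_⟩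
      rw [leibniz_lie]
      exact add_mem (hpm ⁅p, y⁆) (hYS y hy _ (hpm p))
  let T : LieSubmodule K 𝔤 M :=
    { sInf S with lie_mem := fun {p _} hm => (mem_V.1 (sInf_le hV hm)).2 p }
  exact le_trans (b := T.toSubmodule)
    (LieSubmodule.lieSpan_le.2 (Set.singleton_subset_iff.2 hwS)) (sInf_le ⟨hw, hU⟩)

end CyclicSubmodule

section WeightGraded

variable {K 𝔤 : Type*} [Field K] [CharZero K] [LieRing 𝔤] [LieAlgebra K 𝔤]
  [FiniteDimensional K 𝔤] [IsKilling K 𝔤]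
  {H : LieSubalgebra K 𝔤} [H.IsCartanSubalgebra] [IsTriangularizable K H 𝔤]
  {M N : Type*} [AddCommGroup M] [Module K M] [LieRingModule 𝔤 M] [LieModule K 𝔤 M]
  [AddCommGroup N] [Module K N] [LieRingModule 𝔤 N] [LieModule K 𝔤 N]

theorem IsWeightGraded.lie_eq_zero (hS : HasSimplyLacedRoots (IsKilling.rootSystem H))
    (hM : IsWeightGraded H M)
    {ν : Weight K H 𝔤} (hν : ν.IsNonZero) {χ : H → K} (hχ : χ ≠ 0) {n : ℕ}
    (hn : χ (IsKilling.coroot ν) = n) {y : 𝔤} (hy : y ∈ weightSpace 𝔤 (ν : H → K)) {m : M}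
    (hm : m ∈ weightSpace M χ) : ⁅y, m⁆ = 0 := by
  refine hM.eq_zero_of_forall_ne (hS.ne_of_apply_coroot hν (n := n) ?_ ?_)
    (lie_mem_weightSpace (rfl : (ν : H → K) + χ = ν + χ) hy hm)
  · rw [Pi.add_apply, IsKilling.root_apply_coroot hν, hn, add_comm]
  · simpa using hχ

theorem IsWeightGraded.exists_pow_toEnd_ne_zero
    (hS : HasSimplyLacedRoots (IsKilling.rootSystem H)) (hM : IsWeightGraded H M)
    {ν : Weight K H 𝔤} (hν : ν.IsNonZero) {χ : H → K} (hχ : χ ≠ 0) {n : ℕ}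
    (hn : χ (IsKilling.coroot ν) = n) {m : M} (hm : m ∈ weightSpace M χ) (hm0 : m ≠ 0) :
    ∃ f : 𝔤, (toEnd K 𝔤 M f ^ n) m ≠ 0 ∧
      (toEnd K 𝔤 M f ^ n) m ∈ weightSpace M (χ - (n : K) • (ν : H → K)) := by
  obtain ⟨h, e, f, ht, he, hf⟩ := IsKilling.exists_isSl2Triple_of_weight_isNonZero hν
  obtain rfl := ht.h_eq_coroot hν he hf
  rw [← weightSpace_eq_rootSpace] at he hf
  have hprim : ht.HasPrimitiveVectorWith m (n : K) :=
    ⟨hm0, by rw [← hn]; exact mem_weightSpace_iff.1 hm _, hM.lie_eq_zero hS hν hχ hn he hm⟩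
  refine ⟨f, hprim.pow_toEnd_f_ne_zero_of_eq_nat rfl le_rfl, ?_⟩
  simpa [sub_eq_add_neg] using toEnd_pow_mem_weightSpace hf hm n

/-- The weight vectors of `𝔤` whose weight is negative on the coroot of `α`. -/
def negativeVectors (α : Weight K H 𝔤) : Set 𝔤 :=
  {y | ∃ μ : Weight K H 𝔤, y ∈ weightSpace 𝔤 (μ : H → K) ∧
    ∃ n : ℕ, μ (IsKilling.coroot α) = -(n + 1)}

theorem IsWeightGraded.lie_mem_span (hS : HasSimplyLacedRoots (IsKilling.rootSystem H))
    (hM : IsWeightGraded H M) {α : Weight K H 𝔤} (hα : α.IsNonZero) {w : M}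
    (hw : w ∈ weightSpace M (α : H → K)) (p : 𝔤) :
    ⁅p, w⁆ ∈ Submodule.span K (insert w ((⁅·, w⁆) '' negativeVectors α)) := by
  refine lie_mem_of_forall_weight (H := H) (fun μ y hy => ?_) p
  by_cases hμ : μ.IsZero
  · rw [hμ.eq] at hy
    have hyw := mem_weightSpace_iff.1 hw ⟨y, mem_of_mem_weightSpace_zero hy⟩
    exact hyw ▸ Submodule.smul_mem _ _ (Submodule.subset_span (Set.mem_insert _ _))
  have hnonneg (n : ℕ) (hn : μ (IsKilling.coroot α) = n) : ⁅y, w⁆ = 0 := by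
    refine hM.eq_zero_of_forall_ne (hS.ne_of_apply_coroot hα (n := n) ?_ ?_)
      (lie_mem_weightSpace rfl hy hw)
    · rw [Pi.add_apply, hn, IsKilling.root_apply_coroot hα]
    · exact fun h => hμ (add_eq_right.1 h)
  have hneg (n : ℕ) (hn : μ (IsKilling.coroot α) = -(n + 1)) :
      ⁅y, w⁆ ∈ Submodule.span K (insert w ((⁅·, w⁆) '' negativeVectors α)) :=
    Submodule.subset_span (Set.mem_insert_of_mem _ ⟨y, ⟨μ, hy, n, hn⟩, rfl⟩)
  rcases hS.apply_coroot μ hα with h | h | h | ⟨-, h⟩ | ⟨-, h⟩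
  · rw [hnonneg 0 (by simpa using h)]; exact zero_mem _
  · rw [hnonneg 1 (by simpa using h)]; exact zero_mem _
  · exact hneg 0 (by simpa using h)
  · rw [hnonneg 2 (by simpa using h)]; exact zero_mem _
  · exact hneg 1 (by rw [h]; norm_num)

theorem IsWeightGraded.lie_mem_iSup_ne (hS : HasSimplyLacedRoots (IsKilling.rootSystem H))
    (hM : IsWeightGraded H M) {α : Weight K H 𝔤} (hα : α.IsNonZero) {y : 𝔤}
    (hy : y ∈ negativeVectors α) {χ : H → K} {m : M} (hm : m ∈ weightSpace M χ) :
    ⁅y, m⁆ ∈ ⨆ (ψ : H → K) (_ : ψ ≠ α), (weightSpace M ψ).toSubmodule := by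
  obtain ⟨μ, hy, n, hn⟩ := hy
  by_cases hχ : (μ + χ : H → K) = α
  · have hval : χ (IsKilling.coroot α) = (n + 1 : ℕ) + 2 := by
      have := congr_fun hχ (IsKilling.coroot α)
      rw [Pi.add_apply, hn, IsKilling.root_apply_coroot hα] at this
      push_cast
      linear_combination this
    have hne : χ ≠ α := by
      rintro rfl
      rw [IsKilling.root_apply_coroot hα] at hval
      exact Nat.cast_add_one_ne_zero (R := K) n (by push_cast at hval; linear_combination -hval)
    rw [hM.eq_zero_of_forall_ne (hS.ne_of_apply_coroot hα hval hne) hm, lie_zero]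
    exact zero_mem _
  · exact Submodule.mem_iSup_of_mem _
      (Submodule.mem_iSup_of_mem hχ (lie_mem_weightSpace rfl hy hm))

theorem IsWeightGraded.mem_span_of_mem_lieSpan
    (hS : HasSimplyLacedRoots (IsKilling.rootSystem H)) (hM : IsWeightGraded H M)
    {α : Weight K H 𝔤} (hα : α.IsNonZero) {w m : M} (hw : w ∈ weightSpace M (α : H → K))
    (hm : m ∈ LieSubmodule.lieSpan K 𝔤 {w}) (hmα : m ∈ weightSpace M (α : H → K)) :
    m ∈ K ∙ w := by
  let V : Submodule K M := ⨆ (χ : H → K) (_ : χ ≠ α), (weightSpace M χ).toSubmodule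
  have hle : (LieSubmodule.lieSpan K 𝔤 {w}).toSubmodule ≤ (K ∙ w) ⊔ V := by
    refine lieSpan_singleton_le (hM.lie_mem_span hS hα hw)
      (Submodule.mem_sup_left (Submodule.mem_span_singleton_self w)) fun y hy => ?_
    have hlower {χ : H → K} {m : M} (hm : m ∈ weightSpace M χ) : ⁅y, m⁆ ∈ (K ∙ w) ⊔ V :=
      Submodule.mem_sup_right (hM.lie_mem_iSup_ne hS hα hy hm)
    change (K ∙ w) ⊔ V ≤ Submodule.comap (toEnd K 𝔤 M y) ((K ∙ w) ⊔ V)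
    exact sup_le ((Submodule.span_singleton_le_iff_mem _ _).2 (hlower hw))
      (iSup₂_le fun χ _ m hm => hlower hm)
  obtain ⟨u, hu, v, hv, rfl⟩ := Submodule.mem_sup.1 (hle hm)
  have hdisj : Disjoint (weightSpace M (α : H → K)).toSubmodule V := by
    have := LieSubmodule.iSupIndep_toSubmodule.2 (iSupIndep_weightSpace_fun H M)
    exact this α
  have huα : u ∈ weightSpace M (α : H → K) := (Submodule.span_singleton_le_iff_mem _ _).2 hw hu
  have hv0 := Submodule.disjoint_def.1 hdisj v (by simpa using sub_mem hmα huα) hv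
  rwa [hv0, add_zero]

end WeightGraded

theorem lieIdeal_eq_top_of_mem {K 𝔤 : Type*} [CommRing K] [LieRing 𝔤] [LieAlgebra K 𝔤]
    [LieAlgebra.IsSimple K 𝔤] {I : LieIdeal K 𝔤} {x : 𝔤} (hx : x ∈ I) (h0 : x ≠ 0) : I = ⊤ :=
  (LieAlgebra.IsSimple.eq_bot_or_eq_top I).resolve_left fun hI =>
    h0 ((LieSubmodule.mem_bot x).1 (hI ▸ hx))

section AdjointSection

variable {K 𝔤 : Type*} [Field K] [CharZero K] [LieRing 𝔤] [LieAlgebra K 𝔤]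
  [FiniteDimensional K 𝔤] [LieAlgebra.IsSimple K 𝔤]
  {H : LieSubalgebra K 𝔤} [H.IsCartanSubalgebra] [IsTriangularizable K H 𝔤]
  {M : Type*} [AddCommGroup M] [Module K M] [LieRingModule 𝔤 M] [LieModule K 𝔤 M]

theorem IsWeightGraded.lie_eq_zero_of_disjoint_weightSpace
    (hS : HasSimplyLacedRoots (IsKilling.rootSystem H)) (hM : IsWeightGraded H M)
    {α : Weight K H 𝔤} (hα : α.IsNonZero) {N : LieSubmodule K 𝔤 M}
    (hN : ∀ m ∈ N, m ∈ weightSpace M (α : H → K) → m = 0) {m : M} (hm : m ∈ N) (y : 𝔤) :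
    ⁅y, m⁆ = 0 := by
  have hroot (ν : Weight K H 𝔤) (hν : ν.IsNonZero) :
      ∀ m ∈ N, m ∈ weightSpace M (ν : H → K) → m = 0 := by
    refine hS.root_induction (p := fun ν => ∀ m ∈ N, m ∈ weightSpace M (ν : H → K) → m = 0)
      hα hν (fun μ ν ω _ hν hω0 n hn hω ih m hmN hm => ?_) hN
    by_contra hm0
    have hωn : ω (IsKilling.coroot ν) = -n := by
      rw [hω, Pi.sub_apply, Pi.smul_apply, IsKilling.root_apply_coroot hν, hn, smul_eq_mul]
      ring
    have hωneg : ω (IsKilling.coroot (-ν)) = n := by rw [apply_coroot_neg, hωn, neg_neg]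
    obtain ⟨f, hf0, hf⟩ :=
      hM.exists_pow_toEnd_ne_zero hS (Weight.IsNonZero.neg hν) hω0 hωneg hm hm0
    refine hf0 (ih _ ?_ (by simpa [hω] using hf))
    exact Module.End.pow_apply_mem_of_forall_mem n (fun _ => N.lie_mem) m hmN
  have hzero : m ∈ weightSpace M (0 : H → K) :=
    hM.mem_weightSpace_zero (φ := LieSubmodule.Quotient.mk' N)
      (fun ν hν m hm hmN => hroot ν hν m ((LieSubmodule.Quotient.mk_eq_zero N).1 hmN) hm)
      ((LieSubmodule.Quotient.mk_eq_zero N).2 hm)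
  rw [← Submodule.mem_bot K]
  refine lie_mem_of_forall_weight (H := H) (fun μ z hz => ?_) y
  rw [Submodule.mem_bot]
  by_cases hμ : μ.IsZero
  · rw [hμ.eq] at hz
    simpa using mem_weightSpace_iff.1 hzero ⟨z, mem_of_mem_weightSpace_zero hz⟩
  · exact hroot μ hμ _ (N.lie_mem hm) (lie_mem_weightSpace (by simp) hz hzero)

theorem IsWeightGraded.eq_zero_of_mem_lieSpan
    (hS : HasSimplyLacedRoots (IsKilling.rootSystem H)) (hM : IsWeightGraded H M)
    {α : Weight K H 𝔤} (hα : α.IsNonZero) {w : M} (hw : w ∈ weightSpace M (α : H → K))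
    {φ : M →ₗ⁅K,𝔤⁆ 𝔤} (hφw : φ w ≠ 0) {m : M} (hm : m ∈ LieSubmodule.lieSpan K 𝔤 {w})
    (hφm : φ m = 0) : m = 0 := by
  have hmultiple {n : M} (hn : n ∈ LieSubmodule.lieSpan K 𝔤 {w})
      (hnα : n ∈ weightSpace M (α : H → K)) : ∃ c : K, c • w = n :=
    Submodule.mem_span_singleton.1 (hM.mem_span_of_mem_lieSpan hS hα hw hn hnα)
  have hlie (y : 𝔤) : ⁅y, m⁆ = 0 := by
    refine hM.lie_eq_zero_of_disjoint_weightSpace hS hα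
      (N := LieSubmodule.lieSpan K 𝔤 {w} ⊓ φ.ker) (fun n hn hnα => ?_) ⟨hm, φ.mem_ker.2 hφm⟩ y
    obtain ⟨c, rfl⟩ := hmultiple hn.1 hnα
    have hc : c • φ w = 0 := by simpa using φ.mem_ker.1 hn.2
    rw [(smul_eq_zero.1 hc).resolve_right hφw, zero_smul]
  have hwT := LieSubmodule.subset_lieSpan (R := K) (L := 𝔤) (Set.mem_singleton w)
  -- On the submodule generated by `w` the Casimir endomorphism is the identity, since it fixes `w`;
  -- but it kills vectors on which `𝔤` acts trivially, such as `m`.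
  let Ω : M →ₗ⁅K,𝔤⁆ M := { casimir K 𝔤 M with map_lie' := casimir_lie _ _ }
  have hΩT : Ω w ∈ LieSubmodule.lieSpan K 𝔤 {w} := casimir_apply (K := K) (𝔤 := 𝔤) w ▸
    sum_mem fun _ _ => LieSubmodule.lie_mem _ (LieSubmodule.lie_mem _ hwT)
  have hΩw : Ω w = w := by
    obtain ⟨c, hc⟩ := hmultiple hΩT (map_mem_weightSpace Ω hw)
    have hcφ : c • φ w = φ w := by
      rw [← map_smul, hc]
      exact (map_casimir φ w).trans (casimir_adjoint _)
    rwa [smul_left_injective K hφw (hcφ.trans (one_smul K _).symm), one_smul, eq_comm] at hc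
  have hker : m ∈ (Ω - LieModuleHom.id).ker :=
    LieSubmodule.lieSpan_le.2 (Set.singleton_subset_iff.2 (sub_eq_zero.2 hΩw)) hm
  have hΩm : Ω m = m := sub_eq_zero.1 hker
  rw [← hΩm]
  change casimir K 𝔤 M m = 0
  simp only [casimir_apply, hlie, lie_zero, Finset.sum_const_zero]

theorem IsWeightGraded.exists_section
    (hS : HasSimplyLacedRoots (IsKilling.rootSystem H)) (hM : IsWeightGraded H M)
    {α : Weight K H 𝔤} (hα : α.IsNonZero) {w : M} (hw : w ∈ weightSpace M (α : H → K))
    {φ : M →ₗ⁅K,𝔤⁆ 𝔤} (hφw : φ w ≠ 0) : ∃ σ : 𝔤 →ₗ⁅K,𝔤⁆ M, σ (φ w) = w := by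
  let T := LieSubmodule.lieSpan K 𝔤 {w}
  have hwT : w ∈ T := LieSubmodule.subset_lieSpan (Set.mem_singleton w)
  let π : T →ₗ⁅K,𝔤⁆ 𝔤 := φ.comp T.incl
  have hinj : Function.Injective π := (injective_iff_map_eq_zero π).2 fun t ht =>
    Subtype.ext (hM.eq_zero_of_mem_lieSpan hS hα hw hφw t.2 ht)
  have hsurj : Function.Surjective π :=
    π.range_eq_top.1 (lieIdeal_eq_top_of_mem ((π.mem_range _).2 ⟨⟨w, hwT⟩, rfl⟩) hφw)
  let E : T ≃ₗ⁅K,𝔤⁆ 𝔤 := { π, LinearEquiv.ofBijective (π : T →ₗ[K] 𝔤) ⟨hinj, hsurj⟩ with }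
  exact ⟨T.incl.comp E.symm, congr_arg Subtype.val (E.symm_apply_apply ⟨w, hwT⟩)⟩

end AdjointSection

section Product

variable {K 𝔤 M N : Type*} [CommRing K] [LieRing 𝔤] [LieAlgebra K 𝔤]
  [AddCommGroup M] [Module K M] [LieRingModule 𝔤 M] [LieModule K 𝔤 M]
  [AddCommGroup N] [Module K N] [LieRingModule 𝔤 N] [LieModule K 𝔤 N]

/-- The componentwise action of a Lie ring on a product of two modules. -/
instance prodLieRingModule : LieRingModule 𝔤 (M × N) where
  bracket y m := (⁅y, m.1⁆, ⁅y, m.2⁆)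
  add_lie := fun y z m => by ext <;> exact add_lie ..
  lie_add := fun y m n => by ext <;> exact lie_add ..
  leibniz_lie := fun y z m => by ext <;> exact leibniz_lie ..

theorem lie_prod (y : 𝔤) (m : M × N) : ⁅y, m⁆ = (⁅y, m.1⁆, ⁅y, m.2⁆) := rfl

instance prodLieModule : LieModule K 𝔤 (M × N) where
  smul_lie := fun c y m => by ext <;> exact smul_lie ..
  lie_smul := fun c y m => by ext <;> exact lie_smul ..

variable (K 𝔤 M N) in
/-- The first projection of a product of modules. -/
def fstLieModuleHom : M × N →ₗ⁅K,𝔤⁆ M := { LinearMap.fst K M N with map_lie' := rfl }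

variable (K 𝔤 M N) in
/-- The second projection of a product of modules. -/
def sndLieModuleHom : M × N →ₗ⁅K,𝔤⁆ N := { LinearMap.snd K M N with map_lie' := rfl }

end Product

section ProductWeights

variable {K 𝔤 M N : Type*} [Field K] [LieRing 𝔤] [LieAlgebra K 𝔤]
  {H : LieSubalgebra K 𝔤}
  [AddCommGroup M] [Module K M] [LieRingModule 𝔤 M] [LieModule K 𝔤 M]
  [AddCommGroup N] [Module K N] [LieRingModule 𝔤 N] [LieModule K 𝔤 N]

theorem mem_weightSpace_prod {χ : H → K} {m : M × N} :
    m ∈ weightSpace (M × N) χ ↔ m.1 ∈ weightSpace M χ ∧ m.2 ∈ weightSpace N χ := by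
  simp only [mem_weightSpace_iff, lie_prod, Prod.ext_iff, Prod.smul_fst, Prod.smul_snd, forall_and]

theorem IsWeightGraded.prod [LieRing.IsNilpotent H] (hM : IsWeightGraded H M)
    (hN : IsWeightGraded H N) : IsWeightGraded H (M × N) := by
  let U : LieSubmodule K H (M × N) := ⨆ ν : Weight K H 𝔤, weightSpace (M × N) (ν : H → K)
  have hU (ν : Weight K H 𝔤) : weightSpace (M × N) (ν : H → K) ≤ U :=
    le_iSup (fun ν : Weight K H 𝔤 => weightSpace (M × N) (ν : H → K)) ν
  have hinl := hM.mem_of_forall_weight (U := U.toSubmodule.comap (LinearMap.inl K M N))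
    fun ν m hm => hU ν (mem_weightSpace_prod.2 ⟨hm, zero_mem _⟩)
  have hinr := hN.mem_of_forall_weight (U := U.toSubmodule.comap (LinearMap.inr K M N))
    fun ν n hn => hU ν (mem_weightSpace_prod.2 ⟨zero_mem _, hn⟩)
  rw [IsWeightGraded, eq_top_iff]
  rintro ⟨m, n⟩ -
  simpa using U.add_mem (hinl m) (hinr n)

end ProductWeights

section AdjointHom

variable {K 𝔤 : Type*} [Field K] [CharZero K] [LieRing 𝔤] [LieAlgebra K 𝔤]
  [FiniteDimensional K 𝔤] [LieAlgebra.IsSimple K 𝔤]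
  {H : LieSubalgebra K 𝔤} [H.IsCartanSubalgebra] [IsTriangularizable K H 𝔤]
  {M : Type*} [AddCommGroup M] [Module K M] [LieRingModule 𝔤 M] [LieModule K 𝔤 M]

theorem IsWeightGraded.exists_lieModuleHom
    (hS : HasSimplyLacedRoots (IsKilling.rootSystem H)) (hM : IsWeightGraded H M)
    {α : Weight K H 𝔤} (hα : α.IsNonZero) {y : 𝔤} (hy : y ∈ weightSpace 𝔤 (α : H → K))
    (hy0 : y ≠ 0) {x : M} (hx : x ∈ weightSpace M (α : H → K)) :
    ∃ φ : 𝔤 →ₗ⁅K,𝔤⁆ M, φ y = x := by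
  -- The submodule of `𝔤 × M` generated by `(y, x)` is the graph of `φ`.
  obtain ⟨σ, hσ⟩ := ((isWeightGraded_adjoint H).prod hM).exists_section hS hα (w := (y, x))
    (mem_weightSpace_prod.2 ⟨hy, hx⟩) (φ := fstLieModuleHom K 𝔤 𝔤 M) hy0
  exact ⟨(sndLieModuleHom K 𝔤 𝔤 M).comp σ, congr_arg Prod.snd hσ⟩

theorem lieModuleHom_ext {K 𝔤 M : Type*} [CommRing K] [LieRing 𝔤] [LieAlgebra K 𝔤]
    [LieAlgebra.IsSimple K 𝔤] [AddCommGroup M] [Module K M] [LieRingModule 𝔤 M]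
    {y : 𝔤} (hy : y ≠ 0) {φ ψ : 𝔤 →ₗ⁅K,𝔤⁆ M} (h : φ y = ψ y) : φ = ψ := by
  have hker : (φ - ψ).ker = ⊤ := lieIdeal_eq_top_of_mem (x := y) (sub_eq_zero.2 h) hy
  ext z
  have hz : z ∈ (φ - ψ).ker := hker ▸ LieSubmodule.mem_top z
  exact sub_eq_zero.1 hz

end AdjointHom

/-! ### Transfer maps -/

section RootVectors

variable {K 𝔤 : Type*} [Field K] [LieRing 𝔤] [LieAlgebra K 𝔤]
  [FiniteDimensional K 𝔤] [IsKilling K 𝔤]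
  {H : LieSubalgebra K 𝔤} [H.IsCartanSubalgebra] [IsTriangularizable K H 𝔤]

/-- Root vectors `e α` such that `[e α, e (-α)]` is the coroot of `α`. The value of `e` at the
weight `0` is irrelevant. -/
structure IsRootVectorFamily (e : Weight K H 𝔤 → 𝔤) : Prop where
  mem_weightSpace : ∀ ν : Weight K H 𝔤, ν.IsNonZero → e ν ∈ weightSpace 𝔤 (ν : H → K)
  lie_neg : ∀ ν : Weight K H 𝔤, ν.IsNonZero → ⁅e ν, e (-ν)⁆ = (IsKilling.coroot ν : 𝔤)

variable {e : Weight K H 𝔤 → 𝔤}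

theorem IsRootVectorFamily.neg_mem_weightSpace (he : IsRootVectorFamily e) {ν : Weight K H 𝔤}
    (hν : ν.IsNonZero) : e (-ν) ∈ weightSpace 𝔤 (-(ν : H → K)) := by
  simpa using he.mem_weightSpace (-ν) (Weight.IsNonZero.neg hν)

variable [CharZero K]

theorem IsRootVectorFamily.isSl2Triple (he : IsRootVectorFamily e) {ν : Weight K H 𝔤}
    (hν : ν.IsNonZero) : IsSl2Triple (IsKilling.coroot ν : 𝔤) (e ν) (e (-ν)) where
  h_ne_zero := by simpa using hν
  lie_e_f := he.lie_neg ν hν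
  lie_h_e_nsmul := by
    have h := mem_weightSpace_iff.1 (he.mem_weightSpace ν hν) (IsKilling.coroot ν)
    rw [h, IsKilling.root_apply_coroot hν, ofNat_smul_eq_nsmul]
  lie_h_f_nsmul := by
    have h := mem_weightSpace_iff.1 (he.neg_mem_weightSpace hν) (IsKilling.coroot ν)
    rw [h, Pi.neg_apply, IsKilling.root_apply_coroot hν, neg_smul, ofNat_smul_eq_nsmul]

theorem IsRootVectorFamily.ne_zero (he : IsRootVectorFamily e) {ν : Weight K H 𝔤}
    (hν : ν.IsNonZero) : e ν ≠ 0 :=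
  (he.isSl2Triple hν).e_ne_zero

theorem IsRootVectorFamily.exists_smul_eq (he : IsRootVectorFamily e) {ν : Weight K H 𝔤}
    (hν : ν.IsNonZero) {x : 𝔤} (hx : x ∈ weightSpace 𝔤 (ν : H → K)) : ∃ c : K, c • e ν = x := by
  have hmem := he.mem_weightSpace ν hν
  rw [weightSpace_eq_rootSpace] at hx hmem
  obtain ⟨c, hc⟩ := (finrank_eq_one_iff_of_nonzero' (⟨e ν, hmem⟩ : rootSpace H ν)
    (fun h => he.ne_zero hν (congr_arg Subtype.val h))).1
      (IsKilling.finrank_rootSpace_eq_one ν hν) ⟨x, hx⟩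
  exact ⟨c, congr_arg Subtype.val hc⟩

variable {M : Type*} [AddCommGroup M] [Module K M] [LieRingModule 𝔤 M] [LieModule K 𝔤 M]

theorem IsRootVectorFamily.hasPrimitiveVectorWith
    (hS : HasSimplyLacedRoots (IsKilling.rootSystem H)) (he : IsRootVectorFamily e)
    (hM : IsWeightGraded H M) {ν : Weight K H 𝔤} (hν : ν.IsNonZero) {χ : H → K} (hχ : χ ≠ 0) {n : ℕ}
    (hn : χ (IsKilling.coroot ν) = n) {m : M} (hm : m ∈ weightSpace M χ) (hm0 : m ≠ 0) :
    (he.isSl2Triple hν).HasPrimitiveVectorWith m (n : K) where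
  ne_zero := hm0
  lie_h := by rw [← hn, mem_weightSpace_iff.1 hm]
  lie_e := hM.lie_eq_zero hS hν hχ hn (he.mem_weightSpace ν hν) hm

theorem IsWeightGraded.toEnd_pow_three (hS : HasSimplyLacedRoots (IsKilling.rootSystem H))
    (hM : IsWeightGraded H M) {ν : Weight K H 𝔤} (hν : ν.IsNonZero) {y : 𝔤}
    (hy : y ∈ weightSpace 𝔤 (ν : H → K)) : toEnd K 𝔤 M y ^ 3 = 0 := by
  rw [← LinearMap.ker_eq_top, Submodule.eq_top_iff']
  refine hM.mem_of_forall_weight fun χ m hm => ?_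
  have key (n : ℕ) (h0 : n ≠ 0) (hn : χ (IsKilling.coroot ν) + 4 = n) :
      (toEnd K 𝔤 M y ^ 3) m = 0 := by
    have hval : ((χ : H → K) + ((3 : ℕ) : K) • (ν : H → K)) (IsKilling.coroot ν) = n + 2 := by
      rw [Pi.add_apply, Pi.smul_apply, IsKilling.root_apply_coroot hν, ← hn, smul_eq_mul]
      push_cast
      ring
    refine hM.eq_zero_of_forall_ne (hS.ne_of_apply_coroot hν hval fun h => h0 ?_)
      (toEnd_pow_mem_weightSpace hy hm 3)
    rw [h, IsKilling.root_apply_coroot hν] at hval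
    simpa using hval
  rcases hS.apply_coroot χ hν with h | h | h | ⟨-, h⟩ | ⟨-, h⟩
  · exact key 4 (by norm_num) (by rw [h]; norm_num)
  · exact key 5 (by norm_num) (by rw [h]; norm_num)
  · exact key 3 (by norm_num) (by rw [h]; norm_num)
  · exact key 6 (by norm_num) (by rw [h]; norm_num)
  · exact key 2 (by norm_num) (by rw [h]; norm_num)

end RootVectors

section Exponential

variable {K V : Type*} [Field K] [LieRing V] [LieAlgebra K V] {f : Module.End K V}

theorem expNilpotent_eq_of_pow_three (hf : f ^ 3 = 0) :
    expNilpotent f = 1 + f + (2 : K)⁻¹ • f ^ 2 := by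
  have hclass : nilpotencyClass f ≤ 3 := Nat.sInf_le hf
  have hsum : expNilpotent f = ∑ n ∈ Finset.range 3, (n.factorial : K)⁻¹ • f ^ n := by
    refine Finset.sum_subset (Finset.range_mono hclass) fun n _ hn => ?_
    rw [Finset.mem_range, not_lt] at hn
    rw [pow_eq_zero_of_le hn (pow_nilpotencyClass ⟨3, hf⟩), smul_zero]
  simp [hsum, Finset.sum_range_succ, Nat.factorial]

theorem isUnit_expNilpotent (hf : f ^ 3 = 0) : IsUnit (expNilpotent f) := by
  have hcomm : Commute f (1 + (2 : K)⁻¹ • f) :=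
    (Commute.one_right f).add_right ((Commute.refl f).smul_right _)
  rw [expNilpotent_eq_of_pow_three hf,
    show 1 + f + (2 : K)⁻¹ • f ^ 2 = 1 + f * (1 + (2 : K)⁻¹ • f) by
      rw [mul_add, mul_one, mul_smul_comm, ← sq, add_assoc]]
  exact (hcomm.isNilpotent_mul_right ⟨3, hf⟩).isUnit_one_add

variable [CharZero K]

theorem expNilpotent_reflection_apply {𝔤 : Type*} [LieRing 𝔤] [LieAlgebra K 𝔤]
    [LieRingModule 𝔤 V] [LieModule K 𝔤 V] {h e f : 𝔤} {t : IsSl2Triple h e f} {x : V} {n : ℕ}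
    (hn : n ≤ 2) (hx : t.HasPrimitiveVectorWith x (n : K))
    (he : toEnd K 𝔤 V e ^ 3 = 0) (hf : toEnd K 𝔤 V f ^ 3 = 0) :
    ∃ c : K, (expNilpotent (toEnd K 𝔤 V e) * expNilpotent (-toEnd K 𝔤 V f) *
      expNilpotent (toEnd K 𝔤 V e)) x = c • (toEnd K 𝔤 V f ^ n) x := by
  have e₀ : ⁅e, x⁆ = 0 := hx.lie_e
  have e₁ : ⁅e, ⁅f, x⁆⁆ = (n : K) • x := by simpa using hx.lie_e_pow_succ_toEnd_f 0
  have e₂ : ⁅e, ⁅f, ⁅f, x⁆⁆⁆ = (2 * (n - 1) : K) • ⁅f, x⁆ := by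
    convert hx.lie_e_pow_succ_toEnd_f 1 using 2 <;> norm_num [pow_succ]
  have e₃ : (3 * (n - 2) : K) • ⁅f, ⁅f, x⁆⁆ = 0 := by
    have h₃ := hx.lie_e_pow_succ_toEnd_f 2
    rw [hf, LinearMap.zero_apply, lie_zero] at h₃
    convert h₃.symm using 2 <;> norm_num [pow_succ]
  rw [expNilpotent_eq_of_pow_three he,
    expNilpotent_eq_of_pow_three (f := -toEnd K 𝔤 V f)
      (by rw [Odd.neg_pow (by decide), hf, neg_zero])]
  interval_cases n
  · have f₂ : ⁅f, ⁅f, x⁆⁆ = 0 := by simpa using e₃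
    have f₁ : ⁅f, x⁆ = 0 := by simpa [f₂] using e₂
    exact ⟨1, by simp [pow_succ, e₀, f₁]⟩
  · have f₂ : ⁅f, ⁅f, x⁆⁆ = 0 := by
      refine (smul_eq_zero.1 e₃).resolve_left ?_
      norm_num
    exact ⟨-1, by simp [pow_succ, e₀, e₁, f₂]⟩
  · refine ⟨2⁻¹, ?_⟩
    norm_num at e₁ e₂
    simp only [pow_two, LinearMap.add_apply, Module.End.mul_apply, Module.End.one_apply,
      LinearMap.smul_apply, LinearMap.neg_apply, toEnd_apply_apply, lie_add, lie_neg, lie_smul,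
      lie_zero, e₀, e₁, e₂]
    module

end Exponential

section Transfer

variable {K L : Type*} [Field K] [LieRing L] [LieAlgebra K L] {g : LieSubalgebra K L}
  {H : LieSubalgebra K g}

theorem mem_component_iff {χ : H → K} {x : L} :
    x ∈ component H χ ↔ x ∈ weightSpace L χ :=
  mem_weightSpace_iff.symm

theorem exists_end_expNilpotent (z : g) : ∃ v : Module.End K g, ∀ (φ : g →ₗ⁅K,g⁆ L) (y : g),
    expNilpotent (LieAlgebra.ad K L (z : L)) (φ y) = φ (v y) := by
  refine ⟨∑ n ∈ Finset.range (nilpotencyClass (LieAlgebra.ad K L (z : L))),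
    ((n.factorial : K)⁻¹) • toEnd K g g z ^ n, fun φ y => ?_⟩
  simp only [expNilpotent, LinearMap.sum_apply, LinearMap.smul_apply, map_sum, map_smul,
    ← toEnd_pow_apply_map]
  rfl

variable [FiniteDimensional K g] [H.IsCartanSubalgebra]

theorem IsRootGraded.isWeightGraded (hL : IsRootGraded (K := K) (L := L) H) :
    IsWeightGraded H L := by
  rw [IsWeightGraded, ← LieSubmodule.toSubmodule_eq_top, LieSubmodule.iSup_toSubmodule,
    ← hL.iSup_eq_top]
  exact iSup_congr fun ν => Submodule.ext fun x => mem_component_iff.symm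

variable [CharZero K] [LieAlgebra.IsSimple K g] [IsTriangularizable K H g]
  {e : Weight K H g → g} {α β : Weight K H g}

theorem IsSimplyLaced.hasSimplyLacedRoots (h : IsSimplyLaced H) :
    HasSimplyLacedRoots (IsKilling.rootSystem H) := by
  refine fun i j hij hneg => h i j (fun h => hij (Subtype.ext h)) fun h => hneg ?_
  ext x
  simp [h]

theorem IsChevalleyBasis.isRootVectorFamily (he : IsChevalleyBasis e) :
    IsRootVectorFamily e where
  mem_weightSpace ν hν := by
    rw [weightSpace_eq_rootSpace]
    exact he.mem_rootSpace ν (mem_root_iff.2 hν)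
  lie_neg ν hν := he.lie_neg ν (mem_root_iff.2 hν)

theorem adEta_one (ν : Weight K H g) : (adEta e ν 1 : Module.End K L) =
    expNilpotent (toEnd K g L (e ν)) * expNilpotent (-toEnd K g L (e (-ν))) *
      expNilpotent (toEnd K g L (e ν)) := by
  simp only [adEta, one_smul, inv_one, neg_smul, map_neg]
  rfl

theorem IsRootVectorFamily.isUnit_adEta_one (hS : HasSimplyLacedRoots (IsKilling.rootSystem H))
    (he : IsRootVectorFamily e) (hL : IsWeightGraded H L) {ν : Weight K H g} (hν : ν.IsNonZero) :
    IsUnit (adEta e ν 1 : Module.End K L) := by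
  have hpos := isUnit_expNilpotent (hL.toEnd_pow_three hS hν (he.mem_weightSpace ν hν))
  have hneg := hL.toEnd_pow_three hS (Weight.IsNonZero.neg hν)
    (he.mem_weightSpace (-ν) (Weight.IsNonZero.neg hν))
  rw [adEta_one]
  refine (hpos.mul (isUnit_expNilpotent ?_)).mul hpos
  rw [Odd.neg_pow (by decide), hneg, neg_zero]

theorem IsRootVectorFamily.exists_adEta_one_apply
    (hS : HasSimplyLacedRoots (IsKilling.rootSystem H)) (he : IsRootVectorFamily e)
    (hL : IsWeightGraded H L) {μ ν ω : Weight K H g} (hμ : μ.IsNonZero) (hν : ν.IsNonZero)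
    (hω : ω.IsNonZero) {n : ℕ} (hn : μ (IsKilling.coroot ν) = n)
    (hadd : (ω : H → K) = μ - (n : K) • (ν : H → K)) :
    ∃ c : K, adEta e ν 1 (e μ : L) = c • (e ω : L) := by
  have hμL := map_mem_weightSpace g.incl' (he.mem_weightSpace μ hμ)
  have hneg := Weight.IsNonZero.neg hν
  obtain ⟨c, hc⟩ := expNilpotent_reflection_apply (hS.le_two_of_apply_coroot hν hn)
    (he.hasPrimitiveVectorWith hS hL hν (by simpa using hμ) hn hμL (by simpa using he.ne_zero hμ))
    (hL.toEnd_pow_three hS hν (he.mem_weightSpace ν hν))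
    (hL.toEnd_pow_three hS hneg (he.mem_weightSpace (-ν) hneg))
  have hmem : (toEnd K g g (e (-ν)) ^ n) (e μ) ∈ weightSpace g (ω : H → K) := by
    rw [hadd, sub_eq_add_neg, ← smul_neg]
    exact toEnd_pow_mem_weightSpace (he.neg_mem_weightSpace hν) (he.mem_weightSpace μ hμ) n
  obtain ⟨d, hd⟩ := he.exists_smul_eq hω hmem
  refine ⟨c * d, ?_⟩
  rw [adEta_one]
  refine hc.trans ?_
  rw [toEnd_pow_apply_map, ← hd, map_smul, smul_smul]
  rfl

theorem IsRootVectorFamily.exists_mem_adN (hS : HasSimplyLacedRoots (IsKilling.rootSystem H))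
    (he : IsRootVectorFamily e) (hL : IsWeightGraded H L) (hα : α.IsNonZero) (hβ : β.IsNonZero) :
    ∃ u ∈ adN (L := L) e, ∃ c : K, c ≠ 0 ∧ u (e α : L) = c • (e β : L) := by
  refine hS.root_induction
    (p := fun β => ∃ u ∈ adN (L := L) e, ∃ c : K, c ≠ 0 ∧ u (e α : L) = c • (e β : L)) hα hβ ?_
    ⟨1, one_mem _, 1, one_ne_zero, (one_smul K _).symm⟩
  rintro μ ν ω hμ hν hω n hn hadd ⟨u, hu, c, hc, huc⟩
  let U : L ≃ₗ[K] L := LinearEquiv.ofBijective (adEta e ν 1)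
    ((Module.End.isUnit_iff _).1 (he.isUnit_adEta_one hS hL hν))
  have hU : U ∈ adN e := Subgroup.subset_closure ⟨ν, mem_root_iff.2 hν, 1, one_ne_zero, rfl⟩
  obtain ⟨d, hd⟩ : ∃ d : K, U (e μ : L) = d • (e ω : L) :=
    he.exists_adEta_one_apply hS hL hμ hν hω hn hadd
  have hd0 : d ≠ 0 := by
    rintro rfl
    rw [zero_smul, LinearEquiv.map_eq_zero_iff, ZeroMemClass.coe_eq_zero] at hd
    exact he.ne_zero hμ hd
  refine ⟨U * u, mul_mem hU hu, c * d, mul_ne_zero hc hd0, ?_⟩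
  rw [LinearEquiv.mul_apply, huc, map_smul, hd, smul_smul]

theorem exists_equiv_of_mem_adN {u : L ≃ₗ[K] L} (hu : u ∈ adN e) :
    ∃ v : g ≃ₗ[K] g, ∀ (φ : g →ₗ⁅K,g⁆ L) (y : g), u (φ y) = φ (v y) := by
  induction hu using Subgroup.closure_induction with
  | mem u hu =>
    obtain ⟨ν, -, t, -, hut⟩ := hu
    obtain ⟨v₁, h₁⟩ := exists_end_expNilpotent (L := L) (t • e ν)
    obtain ⟨v₂, h₂⟩ := exists_end_expNilpotent (L := L) (-t⁻¹ • e (-ν))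
    have huv (φ : g →ₗ⁅K,g⁆ L) (y : g) : u (φ y) = φ (v₁ (v₂ (v₁ y))) := by
      rw [← h₁, ← h₂, ← h₁]
      exact LinearMap.congr_fun hut (φ y)
    have hinj : Function.Injective (v₁ ∘ₗ v₂ ∘ₗ v₁) := fun y z hyz =>
      Subtype.ext <| u.injective <|
        (huv g.incl' y).trans ((congr_arg g.incl' hyz).trans (huv g.incl' z).symm)
    exact ⟨LinearEquiv.ofInjectiveEndo _ hinj, huv⟩
  | one => exact ⟨1, fun φ y => rfl⟩
  | mul u₁ u₂ _ _ h₁ h₂ =>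
    obtain ⟨v₁, h₁⟩ := h₁
    obtain ⟨v₂, h₂⟩ := h₂
    refine ⟨v₁ * v₂, fun φ y => ?_⟩
    rw [LinearEquiv.mul_apply, LinearEquiv.mul_apply, h₂, h₁]
  | inv u _ h =>
    obtain ⟨v, h⟩ := h
    refine ⟨v.symm, fun φ y => u.injective ?_⟩
    rw [h, LinearEquiv.apply_symm_apply]
    exact u.apply_symm_apply _

theorem apply_hom_of_mem_adN {u : L ≃ₗ[K] L} (hu : u ∈ adN e) {c : K}
    (huc : u (e α : L) = c • (e β : L)) (φ : g →ₗ⁅K,g⁆ L) : u (φ (e α)) = c • φ (e β) := by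
  obtain ⟨v, hv⟩ := exists_equiv_of_mem_adN hu
  have hve : v (e α) = c • e β := Subtype.ext ((hv g.incl' (e α)).symm.trans huc)
  rw [hv, hve, map_smul]

theorem IsRootVectorFamily.exists_hom (hS : HasSimplyLacedRoots (IsKilling.rootSystem H))
    (he : IsRootVectorFamily e) (hL : IsWeightGraded H L) (hα : α.IsNonZero) {x : L}
    (hx : x ∈ component H (α : H → K)) : ∃ φ : g →ₗ⁅K,g⁆ L, φ (e α) = x :=
  hL.exists_lieModuleHom hS hα (he.mem_weightSpace α hα) (he.ne_zero hα) (mem_component_iff.1 hx)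

theorem IsRootVectorFamily.hom_mem_component (he : IsRootVectorFamily e) (hα : α.IsNonZero)
    (φ : g →ₗ⁅K,g⁆ L) : φ (e α) ∈ component H (α : H → K) :=
  mem_component_iff.2 (map_mem_weightSpace φ (he.mem_weightSpace α hα))

theorem IsRootVectorFamily.theta_apply (hS : HasSimplyLacedRoots (IsKilling.rootSystem H))
    (he : IsRootVectorFamily e) (hL : IsWeightGraded H L) (hα : α.IsNonZero) (hβ : β.IsNonZero)
    {φ : g →ₗ⁅K,g⁆ L} {x : component (L := L) H (α : H → K)} (hx : φ (e α) = x) :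
    (theta e β α x : L) = φ (e β) := by
  have h : ∃ p : (L ≃ₗ[K] L) × K, p.1 ∈ adN e ∧ p.2 ≠ 0 ∧ p.1 (e α : L) = p.2 • (e β : L) ∧
      ∀ x ∈ component H (α : H → K), (p.1 : L →ₗ[K] L) x ∈ component H (β : H → K) := by
    obtain ⟨u, hu, c, hc, huc⟩ := he.exists_mem_adN hS hL hα hβ
    refine ⟨(u, c), hu, hc, huc, fun x hx => ?_⟩
    obtain ⟨φ, rfl⟩ := he.exists_hom hS hL hα hx
    rw [LinearEquiv.coe_coe, apply_hom_of_mem_adN hu huc]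
    exact Submodule.smul_mem _ c (he.hom_mem_component hβ φ)
  obtain ⟨hu, hc, huc, -⟩ := h.choose_spec
  rw [theta, dif_pos h]
  change h.choose.2⁻¹ • h.choose.1 (x : L) = φ (e β)
  rw [← hx, apply_hom_of_mem_adN hu huc, inv_smul_smul₀ hc]

end Transfer

/-! ### The pre-Chevalley involution -/

section HomogeneousComponents

variable {K L : Type*} [Field K] [LieRing L] [LieAlgebra K L]
  {g : LieSubalgebra K L} {H : LieSubalgebra K g} [H.IsCartanSubalgebra]
  {α : Weight K H g} {Λ : Type*} {ℒ : Λ → Submodule K L} {l : Λ}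

theorem mem_coordinateComponent {a : component (L := L) H (α : H → K)} :
    a ∈ coordinateComponent ℒ α l ↔ (a : L) ∈ ℒ l :=
  ⟨fun h => h.2, fun h => ⟨a.2, h⟩⟩

variable [FiniteDimensional K g] [AddCommGroup Λ]

theorem IsRootLatticeGraded.lie_mem_of_mem (hL : IsRootLatticeGraded H ℒ) (y : g) {x : L}
    (hx : x ∈ ℒ l) : ⁅(y : L), x⁆ ∈ ℒ l := by
  simpa using hL.lie_mem 0 l y (hL.le_zero y.2) x hx

theorem IsRootLatticeGraded.iSupIndep_coordinateComponent (hL : IsRootLatticeGraded H ℒ)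
    (α : Weight K H g) : iSupIndep (coordinateComponent ℒ α) := by
  rw [iSupIndep_iff_finsetSum_eq_zero_imp_eq_zero]
  intro s v hv hsum l hl
  refine Subtype.ext ?_
  refine (iSupIndep_iff_finsetSum_eq_zero_imp_eq_zero _).1 hL.grading_independent s
    (fun l => (v l : L)) (fun l hl => mem_coordinateComponent.1 (hv l hl)) ?_ l hl
  rw [← Submodule.coe_sum, hsum, Submodule.coe_zero]

theorem IsRootLatticeGraded.mem_component_of_sum_mem (hL : IsRootLatticeGraded H ℒ) {χ : H → K}
    {s : Finset Λ} {f : Λ → L} (hf : ∀ l ∈ s, f l ∈ ℒ l) (hs : ∑ l ∈ s, f l ∈ component H χ)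
    (hl : l ∈ s) : f l ∈ component H χ := by
  intro h
  rw [← sub_eq_zero]
  refine (iSupIndep_iff_finsetSum_eq_zero_imp_eq_zero _).1 hL.grading_independent s
    (fun l => ⁅((h : g) : L), f l⁆ - χ h • f l)
    (fun l hl => sub_mem (hL.lie_mem_of_mem _ (hf l hl)) (Submodule.smul_mem _ _ (hf l hl)))
    ?_ l hl
  rw [Finset.sum_sub_distrib, ← Finset.smul_sum, ← lie_sum, hs h, sub_self]

theorem IsRootLatticeGraded.iSup_coordinateComponent (hL : IsRootLatticeGraded H ℒ)
    (α : Weight K H g) : ⨆ l, coordinateComponent ℒ α l = ⊤ := by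
  rw [eq_top_iff]
  rintro a -
  have ha : (a : L) ∈ ⨆ l, ℒ l := hL.grading_iSup_eq_top ▸ Submodule.mem_top
  obtain ⟨f, hf, hsum⟩ := (Submodule.mem_iSup_iff_exists_finsupp _ _).1 ha
  rw [Finsupp.sum] at hsum
  have hcomp (l : f.support) : f l ∈ component H (α : H → K) :=
    hL.mem_component_of_sum_mem (fun l _ => hf l) (hsum ▸ a.2) l.2
  have haf : a = ∑ l ∈ f.support.attach, ⟨f l, hcomp l⟩ := by
    refine Subtype.ext ?_
    rw [Submodule.coe_sum, ← hsum]
    exact (Finset.sum_attach f.support f).symm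
  rw [haf]
  exact Submodule.sum_mem _ fun l _ =>
    Submodule.mem_iSup_of_mem (l : Λ) (mem_coordinateComponent.2 (hf l))

variable [CharZero K] [LieAlgebra.IsSimple K g] [IsTriangularizable K H g] {e : Weight K H g → g}

theorem IsRootLatticeGraded.hom_mem (hL : IsRootLatticeGraded H ℒ) (he : IsRootVectorFamily e)
    (hα : α.IsNonZero) {φ : g →ₗ⁅K,g⁆ L} (hφ : φ (e α) ∈ ℒ l) (y : g) : φ y ∈ ℒ l := by
  let I : LieIdeal K g :=
    { (ℒ l).comap (φ : g →ₗ[K] L) with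
      lie_mem := fun {z y} hy => by
        change φ ⁅z, y⁆ ∈ ℒ l
        rw [LieModuleHom.map_lie]
        exact hL.lie_mem_of_mem z hy }
  have hI : I = ⊤ := lieIdeal_eq_top_of_mem (x := e α) hφ (he.ne_zero hα)
  exact (hI ▸ LieSubmodule.mem_top y : y ∈ I)

end HomogeneousComponents

section ChevalleyInvolution

variable {K L : Type*} [Field K] [LieRing L] [LieAlgebra K L]
  {g : LieSubalgebra K L} {H : LieSubalgebra K g}
  {Λ : Type*} [AddCommGroup Λ] {ℒ : Λ → Submodule K L} {τ : L ≃ₗ⁅K⁆ L}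

theorem IsChevalleyInvolution.apply_mem (hτ : IsChevalleyInvolution H ℒ τ) (y : g) :
    τ (y : L) ∈ g :=
  hτ.map_subalgebra ▸ LieSubalgebra.mem_map _ _ _ |>.2 ⟨y, y.2, rfl⟩

theorem IsChevalleyInvolution.apply_mem_neg (hτ : IsChevalleyInvolution H ℒ τ) {l : Λ} {x : L}
    (hx : x ∈ ℒ l) : τ x ∈ ℒ (-l) :=
  hτ.map_grading l ▸ Submodule.mem_map_of_mem hx

/-- The restriction of a Chevalley involution to the grading subalgebra. -/
def IsChevalleyInvolution.restrict (hτ : IsChevalleyInvolution H ℒ τ) : g →ₗ⁅K⁆ g where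
  toLinearMap := (τ : L →ₗ[K] L).restrict fun y hy => hτ.apply_mem ⟨y, hy⟩
  map_lie' := Subtype.ext (LieEquiv.map_lie τ _ _)

theorem IsChevalleyInvolution.restrict_restrict (hτ : IsChevalleyInvolution H ℒ τ) (y : g) :
    hτ.restrict (hτ.restrict y) = y :=
  Subtype.ext (hτ.apply_apply _)

/-- Conjugation `φ ↦ τ ∘ φ ∘ τ` of homomorphisms from the adjoint module to `L`. It corresponds to
the anti-involution of the coordinate algebra. -/
def IsChevalleyInvolution.conj (hτ : IsChevalleyInvolution H ℒ τ) :
    (g →ₗ⁅K,g⁆ L) →ₗ[K] (g →ₗ⁅K,g⁆ L) where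
  toFun φ :=
    { (τ : L →ₗ[K] L) ∘ₗ (φ : g →ₗ[K] L) ∘ₗ (hτ.restrict : g →ₗ[K] g) with
      map_lie' := fun {z y} => by
        change τ (φ (hτ.restrict ⁅z, y⁆)) = ⁅(z : L), τ (φ (hτ.restrict y))⁆
        rw [LieHom.map_lie, LieModuleHom.map_lie]
        exact (LieEquiv.map_lie τ _ _).trans (by rw [← hτ.apply_apply z]; rfl) }
  map_add' φ ψ := LieModuleHom.ext fun y => map_add τ (φ _) (ψ _)
  map_smul' c φ := LieModuleHom.ext fun y => map_smul τ c (φ _)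

theorem IsChevalleyInvolution.conj_apply (hτ : IsChevalleyInvolution H ℒ τ) (φ : g →ₗ⁅K,g⁆ L)
    (y : g) : hτ.conj φ y = τ (φ (hτ.restrict y)) := rfl

theorem IsChevalleyInvolution.apply_hom (hτ : IsChevalleyInvolution H ℒ τ) (φ : g →ₗ⁅K,g⁆ L)
    (y : g) : τ (φ y) = hτ.conj φ (hτ.restrict y) := by
  rw [hτ.conj_apply, hτ.restrict_restrict]

theorem IsChevalleyInvolution.conj_conj (hτ : IsChevalleyInvolution H ℒ τ) (φ : g →ₗ⁅K,g⁆ L) :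
    hτ.conj (hτ.conj φ) = φ := by
  ext y
  rw [hτ.conj_apply, ← hτ.apply_hom, hτ.apply_apply]

theorem IsChevalleyInvolution.conj_incl (hτ : IsChevalleyInvolution H ℒ τ) :
    hτ.conj g.incl' = g.incl' :=
  LieModuleHom.ext fun y => hτ.apply_apply y

variable [CharZero K] [FiniteDimensional K g] [LieAlgebra.IsSimple K g] [H.IsCartanSubalgebra]

theorem IsChevalleyInvolution.apply_cartan (hτ : IsChevalleyInvolution H ℒ τ)
    (hL : IsRootLatticeGraded H ℒ) (h : H) : τ ((h : g) : L) = -((h : g) : L) := by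
  refine hτ.apply_eq_neg _ ⟨fun h' => ?_, hL.le_zero (h : g).2⟩
  rw [Pi.zero_apply, zero_smul]
  exact congr_arg (fun z : H => ((z : g) : L)) (trivial_lie_zero H H h' h)

theorem IsChevalleyInvolution.restrict_mem_weightSpace (hτ : IsChevalleyInvolution H ℒ τ)
    (hL : IsRootLatticeGraded H ℒ) {χ : H → K} {y : g} (hy : y ∈ weightSpace g χ) :
    hτ.restrict y ∈ weightSpace g (-χ) := by
  rw [mem_weightSpace_iff] at hy ⊢
  intro h
  have hh : hτ.restrict h = -h := Subtype.ext (hτ.apply_cartan hL h)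
  have hlie := congr_arg hτ.restrict (hy h)
  rwa [LieHom.map_lie, hh, map_smul, neg_lie, neg_eq_iff_eq_neg, ← neg_smul] at hlie

end ChevalleyInvolution

theorem lie_lie_lie_hom {K L : Type*} [CommRing K] [LieRing L] [LieAlgebra K L]
    {g : LieSubalgebra K L} (φ ψ : g →ₗ⁅K,g⁆ L) {f x y : g}
    (hx : ⁅f, ⁅f, x⁆⁆ = 0) (hy : ⁅f, ⁅f, y⁆⁆ = 0) :
    ⁅(f : L), ⁅(f : L), ⁅φ x, ψ y⁆⁆⁆ = (2 : K) • ⁅φ ⁅f, x⁆, ψ ⁅f, y⁆⁆ := by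
  have hlie (φ : g →ₗ⁅K,g⁆ L) (y : g) : ⁅(f : L), φ y⁆ = φ ⁅f, y⁆ := (φ.map_lie f y).symm
  simp only [leibniz_lie (f : L) (φ _) (ψ _), lie_add, hlie, hx, hy, map_zero, zero_lie, lie_zero,
    zero_add, add_zero, two_smul]

section CoordinateAlgebra

variable {K L : Type*} [Field K] [CharZero K] [LieRing L] [LieAlgebra K L]
  {g : LieSubalgebra K L} [FiniteDimensional K g] [LieAlgebra.IsSimple K g]
  {H : LieSubalgebra K g} [H.IsCartanSubalgebra] [IsTriangularizable K H g]
  {e : Weight K H g → g} {α β γ δ : Weight K H g}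

theorem IsRootVectorFamily.lie_ne_zero (hS : HasSimplyLacedRoots (IsKilling.rootSystem H))
    (he : IsRootVectorFamily e) (hβ : β.IsNonZero) (hγ : γ.IsNonZero) (hδ : δ.IsNonZero)
    (hadd : (δ : H → K) = β + γ) : ⁅e β, e γ⁆ ≠ 0 := by
  have hn : γ (IsKilling.coroot (-β)) = (1 : ℕ) := by
    rw [apply_coroot_neg, hS.apply_coroot_of_add hβ hγ hδ hadd, neg_neg, Nat.cast_one]
  have hprim := he.hasPrimitiveVectorWith hS (isWeightGraded_adjoint H) (Weight.IsNonZero.neg hβ)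
    (by simpa using hγ) hn (he.mem_weightSpace γ hγ) (he.ne_zero hγ)
  simpa using hprim.pow_toEnd_f_ne_zero_of_eq_nat rfl le_rfl

theorem IsRootVectorFamily.lie_neg_lie_neg_eq_zero
    (hS : HasSimplyLacedRoots (IsKilling.rootSystem H)) (he : IsRootVectorFamily e)
    (hβ : β.IsNonZero) (hγ : γ.IsNonZero) (hδ : δ.IsNonZero) (hadd : (δ : H → K) = β + γ) :
    ⁅e (-δ), ⁅e (-δ), e β⁆⁆ = 0 := by
  have hn : (-(γ : H → K)) (IsKilling.coroot (-δ)) = (1 : ℕ) := by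
    rw [Pi.neg_apply, apply_coroot_neg, hS.apply_coroot_add hγ hβ hδ (hadd.trans (add_comm _ _)),
      neg_neg, Nat.cast_one]
  have hneg := Weight.IsNonZero.neg hδ
  refine (isWeightGraded_adjoint H).lie_eq_zero hS hneg (by simpa using hγ) hn
    (he.mem_weightSpace (-δ) hneg) ?_
  exact lie_mem_weightSpace (by simp [hadd]) (he.neg_mem_weightSpace hδ) (he.mem_weightSpace β hβ)

theorem IsRootVectorFamily.lie_neg_lie_neg_ne_zero
    (hS : HasSimplyLacedRoots (IsKilling.rootSystem H)) (he : IsRootVectorFamily e)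
    (hδ : δ.IsNonZero) : ⁅e (-δ), ⁅e (-δ), e δ⁆⁆ ≠ 0 := by
  have hprim := he.hasPrimitiveVectorWith hS (isWeightGraded_adjoint H) hδ (by simpa using hδ)
    (n := 2) (by simp [IsKilling.root_apply_coroot hδ]) (he.mem_weightSpace δ hδ) (he.ne_zero hδ)
  simpa [pow_two] using hprim.pow_toEnd_f_ne_zero_of_eq_nat rfl le_rfl

theorem IsRootVectorFamily.structureConstant_smul (he : IsRootVectorFamily e)
    (hβ : β.IsNonZero) (hγ : γ.IsNonZero) (hδ : δ.IsNonZero) (hadd : (δ : H → K) = β + γ) :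
    structureConstant e β γ δ • e δ = ⁅e β, e γ⁆ := by
  obtain ⟨c, hc⟩ := he.exists_smul_eq hδ
    (lie_mem_weightSpace hadd (he.mem_weightSpace β hβ) (he.mem_weightSpace γ hγ))
  have h : ∃ c : K, ⁅e β, e γ⁆ = c • e δ := ⟨c, hc.symm⟩
  rw [structureConstant, dif_pos h]
  exact h.choose_spec.symm

/-- Homomorphisms from the adjoint module correspond to the elements of the coordinate algebra, by
evaluation at the root vector `e α`. -/
noncomputable def IsRootVectorFamily.homEquiv
    (hS : HasSimplyLacedRoots (IsKilling.rootSystem H)) (he : IsRootVectorFamily e)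
    (hL : IsWeightGraded H L) (hα : α.IsNonZero) :
    (g →ₗ⁅K,g⁆ L) ≃ₗ[K] component (L := L) H (α : H → K) :=
  LinearEquiv.ofBijective
    { toFun := fun φ => ⟨φ (e α), he.hom_mem_component hα φ⟩
      map_add' := fun _ _ => rfl
      map_smul' := fun _ _ => rfl }
    ⟨fun _ _ h => lieModuleHom_ext (he.ne_zero hα) (congr_arg Subtype.val h), fun x => by
      obtain ⟨φ, hφ⟩ := he.exists_hom hS hL hα x.2
      exact ⟨φ, Subtype.ext hφ⟩⟩

theorem IsRootVectorFamily.exists_hom_eq_lie (hS : HasSimplyLacedRoots (IsKilling.rootSystem H))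
    (he : IsRootVectorFamily e) (hL : IsWeightGraded H L) (hβ : β.IsNonZero) (hγ : γ.IsNonZero)
    (hδ : δ.IsNonZero) (hadd : (δ : H → K) = β + γ) (φ ψ : g →ₗ⁅K,g⁆ L) :
    ∃ χ : g →ₗ⁅K,g⁆ L, χ (e δ) = ⁅φ (e β), ψ (e γ)⁆ :=
  he.exists_hom hS hL hδ
    (lie_mem_component H hadd (he.hom_mem_component hβ φ) (he.hom_mem_component hγ ψ))

theorem IsRootVectorFamily.coordinateMul_homEquiv
    (hS : HasSimplyLacedRoots (IsKilling.rootSystem H)) (he : IsRootVectorFamily e)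
    (hL : IsWeightGraded H L) (hα : α.IsNonZero) (hβ : β.IsNonZero) (hγ : γ.IsNonZero)
    (hδ : δ.IsNonZero) (hadd : (δ : H → K) = β + γ) {φ ψ χ : g →ₗ⁅K,g⁆ L}
    (hχ : χ (e δ) = ⁅φ (e β), ψ (e γ)⁆) :
    coordinateMul e α β γ δ hadd (he.homEquiv hS hL hα φ) (he.homEquiv hS hL hα ψ) =
      (structureConstant e β γ δ)⁻¹ • he.homEquiv hS hL hα χ := by
  rw [coordinateMul, LinearMap.smul_apply, LinearMap.smul_apply, LinearMap.mk₂_apply]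
  refine congr_arg _ (Subtype.ext (he.theta_apply hS hL hδ hα ?_))
  exact hχ.trans (congr_arg₂ (⁅·, ·⁆) (he.theta_apply hS hL hα hβ rfl).symm
    (he.theta_apply hS hL hα hγ rfl).symm)

variable {Λ : Type*} [AddCommGroup Λ] {ℒ : Λ → Submodule K L} {τ : L ≃ₗ⁅K⁆ L}

theorem IsChevalleyInvolution.exists_smul_lie_conj
    (hS : HasSimplyLacedRoots (IsKilling.rootSystem H)) (he : IsRootVectorFamily e)
    (hL : IsRootLatticeGraded H ℒ) (hτ : IsChevalleyInvolution H ℒ τ) (hβ : β.IsNonZero)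
    (hγ : γ.IsNonZero) (hδ : δ.IsNonZero) (hadd : (δ : H → K) = β + γ) :
    ∃ k : K, k ≠ 0 ∧ ∃ p : K, ∀ φ ψ χ : g →ₗ⁅K,g⁆ L, χ (e δ) = ⁅φ (e β), ψ (e γ)⁆ →
      k • hτ.conj χ (e δ) = p • ⁅hτ.conj φ (e γ), hτ.conj ψ (e β)⁆ := by
  -- Apply `(ad e_{-δ})²` and then `τ` to `χ(e_δ) = [φ(e_β), ψ(e_γ)]`: the first sends the weights
  -- `β`, `γ` to `-γ`, `-β`, and the second changes their signs.
  have hf := he.neg_mem_weightSpace hδ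
  obtain ⟨r, hr⟩ := he.exists_smul_eq hγ (x := hτ.restrict ⁅e (-δ), e β⁆) <| by
    simpa using hτ.restrict_mem_weightSpace hL
      (lie_mem_weightSpace (ω := -γ) (by simp [hadd]) hf (he.mem_weightSpace β hβ))
  obtain ⟨s, hs⟩ := he.exists_smul_eq hβ (x := hτ.restrict ⁅e (-δ), e γ⁆) <| by
    simpa using hτ.restrict_mem_weightSpace hL
      (lie_mem_weightSpace (ω := -β) (by simp [hadd]) hf (he.mem_weightSpace γ hγ))
  obtain ⟨k, hk⟩ := he.exists_smul_eq hδ (x := hτ.restrict ⁅e (-δ), ⁅e (-δ), e δ⁆⁆) <| by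
    simpa using hτ.restrict_mem_weightSpace hL (lie_mem_weightSpace (ω := -δ) (ψ := 0) (by simp) hf
      (lie_mem_weightSpace (by simp) hf (he.mem_weightSpace δ hδ)))
  refine ⟨k, ?_, 2 * r * s, fun φ ψ χ hχ => ?_⟩
  · rintro rfl
    apply he.lie_neg_lie_neg_ne_zero hS hδ
    rw [← hτ.restrict_restrict ⁅_, _⁆, ← hk, zero_smul, map_zero]
  · have hlie : χ ⁅e (-δ), ⁅e (-δ), e δ⁆⁆ = (2 : K) • ⁅φ ⁅e (-δ), e β⁆, ψ ⁅e (-δ), e γ⁆⁆ := by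
      rw [← lie_lie_lie_hom φ ψ (he.lie_neg_lie_neg_eq_zero hS hβ hγ hδ hadd)
        (he.lie_neg_lie_neg_eq_zero hS hγ hβ hδ (hadd.trans (add_comm _ _))), ← hχ,
        LieModuleHom.map_lie, LieModuleHom.map_lie]
      rfl
    have hτlie := congr_arg τ hlie
    rwa [map_smul, LieEquiv.map_lie, hτ.apply_hom, hτ.apply_hom, hτ.apply_hom, ← hr, ← hs, ← hk,
      map_smul, map_smul, map_smul, smul_lie, lie_smul, smul_smul, smul_smul] at hτlie

theorem IsChevalleyInvolution.conj_apply_eq_lie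
    (hS : HasSimplyLacedRoots (IsKilling.rootSystem H)) (he : IsRootVectorFamily e)
    (hL : IsRootLatticeGraded H ℒ) (hτ : IsChevalleyInvolution H ℒ τ) (hβ : β.IsNonZero)
    (hγ : γ.IsNonZero) (hδ : δ.IsNonZero) (hadd : (δ : H → K) = β + γ) {φ ψ χ : g →ₗ⁅K,g⁆ L}
    (hχ : χ (e δ) = ⁅φ (e β), ψ (e γ)⁆) :
    hτ.conj χ (e δ) = ⁅hτ.conj ψ (e β), hτ.conj φ (e γ)⁆ := by
  obtain ⟨k, hk, p, hp⟩ := hτ.exists_smul_lie_conj hS he hL hβ hγ hδ hadd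
  have hpk : p = -k := by
    -- The constant is determined by the case where `φ` and `ψ` are the inclusion of `g`.
    have hN := he.structureConstant_smul hβ hγ hδ hadd
    have hincl := hp g.incl' g.incl' (structureConstant e β γ δ • g.incl')
      (congr_arg Subtype.val hN)
    rw [map_smul, hτ.conj_incl] at hincl
    have hg : k • ⁅e β, e γ⁆ = p • ⁅e γ, e β⁆ := hN ▸ Subtype.ext hincl
    rw [← lie_skew (e γ), smul_neg, ← neg_smul] at hg
    rw [smul_left_injective K (he.lie_ne_zero hS hβ hγ hδ hadd) hg, neg_neg]
  refine smul_right_injective L hk ((hp φ ψ χ hχ).trans ?_)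
  rw [hpk, ← lie_skew, smul_neg, neg_smul, neg_neg]

theorem IsRootVectorFamily.isGradedAlgebra (hS : HasSimplyLacedRoots (IsKilling.rootSystem H))
    (he : IsRootVectorFamily e) (hL : IsRootLatticeGraded H ℒ) (hα : α.IsNonZero)
    (hβ : β.IsNonZero) (hγ : γ.IsNonZero) (hδ : δ.IsNonZero) (hadd : (δ : H → K) = β + γ) :
    IsGradedAlgebra (coordinateMul e α β γ δ hadd) (coordinateComponent ℒ α) where
  independent := hL.iSupIndep_coordinateComponent α
  iSup_eq_top := hL.iSup_coordinateComponent α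
  mul_mem l k a ha b hb := by
    have hW := hL.isWeightGraded
    obtain ⟨φ, rfl⟩ := (he.homEquiv hS hW hα).surjective a
    obtain ⟨ψ, rfl⟩ := (he.homEquiv hS hW hα).surjective b
    obtain ⟨χ, hχ⟩ := he.exists_hom_eq_lie hS hW hβ hγ hδ hadd φ ψ
    rw [he.coordinateMul_homEquiv hS hW hα hβ hγ hδ hadd hχ]
    refine Submodule.smul_mem _ _ (mem_coordinateComponent.2 (hL.hom_mem he hδ ?_ (e α)))
    rw [hχ]
    exact hL.lie_mem l k _ (hL.hom_mem he hα (mem_coordinateComponent.1 ha) (e β)) _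
      (hL.hom_mem he hα (mem_coordinateComponent.1 hb) (e γ))

/-- Conjugation by a Chevalley involution as a map of the coordinate algebra. -/
noncomputable def IsChevalleyInvolution.bar (hτ : IsChevalleyInvolution H ℒ τ)
    (hS : HasSimplyLacedRoots (IsKilling.rootSystem H)) (he : IsRootVectorFamily e)
    (hL : IsWeightGraded H L) (hα : α.IsNonZero) :
    component (L := L) H (α : H → K) →ₗ[K] component (L := L) H (α : H → K) :=
  (he.homEquiv hS hL hα).conj hτ.conj

theorem IsChevalleyInvolution.bar_homEquiv (hτ : IsChevalleyInvolution H ℒ τ)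
    (hS : HasSimplyLacedRoots (IsKilling.rootSystem H)) (he : IsRootVectorFamily e)
    (hL : IsWeightGraded H L) (hα : α.IsNonZero) (φ : g →ₗ⁅K,g⁆ L) :
    hτ.bar hS he hL hα (he.homEquiv hS hL hα φ) = he.homEquiv hS hL hα (hτ.conj φ) := by
  rw [bar, LinearEquiv.conj_apply_apply, LinearEquiv.symm_apply_apply]

theorem IsChevalleyInvolution.isAntiInvolution_bar (hτ : IsChevalleyInvolution H ℒ τ)
    (hS : HasSimplyLacedRoots (IsKilling.rootSystem H)) (he : IsRootVectorFamily e)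
    (hL : IsRootLatticeGraded H ℒ) (hα : α.IsNonZero) (hβ : β.IsNonZero) (hγ : γ.IsNonZero)
    (hδ : δ.IsNonZero) (hadd : (δ : H → K) = β + γ) :
    IsAntiInvolution (coordinateMul e α β γ δ hadd) (hτ.bar hS he hL.isWeightGraded hα) where
  map_mul a b := by
    have hW := hL.isWeightGraded
    obtain ⟨φ, rfl⟩ := (he.homEquiv hS hW hα).surjective a
    obtain ⟨ψ, rfl⟩ := (he.homEquiv hS hW hα).surjective b
    obtain ⟨χ, hχ⟩ := he.exists_hom_eq_lie hS hW hβ hγ hδ hadd φ ψ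
    rw [he.coordinateMul_homEquiv hS hW hα hβ hγ hδ hadd hχ, map_smul, hτ.bar_homEquiv,
      hτ.bar_homEquiv, hτ.bar_homEquiv, he.coordinateMul_homEquiv hS hW hα hβ hγ hδ hadd
        (hτ.conj_apply_eq_lie hS he hL hβ hγ hδ hadd hχ)]
  bar_bar a := by
    obtain ⟨φ, rfl⟩ := (he.homEquiv hS hL.isWeightGraded hα).surjective a
    rw [hτ.bar_homEquiv, hτ.bar_homEquiv, hτ.conj_conj]

theorem IsChevalleyInvolution.bar_mem (hτ : IsChevalleyInvolution H ℒ τ)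
    (hS : HasSimplyLacedRoots (IsKilling.rootSystem H)) (he : IsRootVectorFamily e)
    (hL : IsRootLatticeGraded H ℒ) (hα : α.IsNonZero) {l : Λ}
    {a : component (L := L) H (α : H → K)} (ha : a ∈ coordinateComponent ℒ α l) :
    hτ.bar hS he hL.isWeightGraded hα a ∈ coordinateComponent ℒ α (-l) := by
  obtain ⟨φ, rfl⟩ := (he.homEquiv hS hL.isWeightGraded hα).surjective a
  rw [hτ.bar_homEquiv, mem_coordinateComponent]
  exact hτ.apply_mem_neg (hL.hom_mem he hα (mem_coordinateComponent.1 ha) _)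

theorem IsChevalleyInvolution.isPreChevalley_bar (hτ : IsChevalleyInvolution H ℒ τ)
    (hS : HasSimplyLacedRoots (IsKilling.rootSystem H)) (he : IsRootVectorFamily e)
    (hL : IsRootLatticeGraded H ℒ) (hα : α.IsNonZero) (hβ : β.IsNonZero) (hγ : γ.IsNonZero)
    (hδ : δ.IsNonZero) (hadd : (δ : H → K) = β + γ) :
    IsPreChevalley (coordinateMul e α β γ δ hadd) (coordinateComponent ℒ α)
      (hτ.bar hS he hL.isWeightGraded hα) where
  toIsAntiInvolution := hτ.isAntiInvolution_bar hS he hL hα hβ hγ hδ hadd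
  map_component l := by
    refine le_antisymm (Submodule.map_le_iff_le_comap.2 fun a ha => hτ.bar_mem hS he hL hα ha)
      fun b hb => ⟨_, neg_neg l ▸ hτ.bar_mem hS he hL hα hb, ?_⟩
    exact (hτ.isAntiInvolution_bar hS he hL hα hβ hγ hδ hadd).bar_bar b

end CoordinateAlgebra

theorem IsA2Pair.add_isNonZero {K L : Type*} [Field K] [CharZero K] [LieRing L] [LieAlgebra K L]
    {g : LieSubalgebra K L} [FiniteDimensional K g] {H : LieSubalgebra K g} [H.IsCartanSubalgebra]
    {β γ δ : Weight K H g} (h : IsA2Pair β γ) (hadd : (δ : H → K) = β + γ) : δ.IsNonZero :=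
  fun h0 => one_ne_zero
    ((LinearIndependent.pair_iff.1 h.linearIndependent) 1 1 (by simp [← hadd, h0.eq])).1

end RootGraded

theorem proposition3p9_general {K L Λ : Type*} [Field K] [CharZero K] [LieRing L] [LieAlgebra K L]
    [AddCommGroup Λ]
    (g : LieSubalgebra K L) [FiniteDimensional K g] [LieAlgebra.IsSimple K g]
    (H : LieSubalgebra K g) [H.IsCartanSubalgebra] [LieModule.IsTriangularizable K H g]
    (ℒ : Λ → Submodule K L) (hL : RootGraded.IsRootLatticeGraded H ℒ)
    (hlaced : RootGraded.IsSimplyLaced H)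
    (τ : L ≃ₗ⁅K⁆ L) (hτ : RootGraded.IsChevalleyInvolution H ℒ τ)
    (e : LieModule.Weight K H g → g) (he : RootGraded.IsRootVectorFamily e)
    (α β γ δ : LieModule.Weight K H g) (hα : α.IsNonZero) (hβ : β.IsNonZero) (hγ : γ.IsNonZero)
    (hδ : δ.IsNonZero) (hadd : (δ : H → K) = β + γ) :
    RootGraded.IsGradedAlgebra (RootGraded.coordinateMul e α β γ δ hadd)
        (RootGraded.coordinateComponent ℒ α) ∧
      ∃ bar : RootGraded.component H (α : H → K) →ₗ[K] RootGraded.component H (α : H → K),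
        RootGraded.IsPreChevalley (RootGraded.coordinateMul e α β γ δ hadd)
          (RootGraded.coordinateComponent ℒ α) bar :=
  have hS := hlaced.hasSimplyLacedRoots
  ⟨he.isGradedAlgebra hS hL hα hβ hγ hδ hadd, _, hτ.isPreChevalley_bar hS he hL hα hβ hγ hδ hadd⟩

theorem proposition3p9 {K L Λ : Type*} [Field K] [CharZero K] [LieRing L] [LieAlgebra K L]
    [AddCommGroup Λ] [Module.Free ℤ Λ]
    (g : LieSubalgebra K L) [FiniteDimensional K g] [LieAlgebra.IsSimple K g]
    (H : LieSubalgebra K g) [H.IsCartanSubalgebra] [LieModule.IsTriangularizable K H g]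
    (ℒ : Λ → Submodule K L) (hL : RootGraded.IsDivisionGraded H ℒ)
    (hlaced : RootGraded.IsSimplyLaced H) (hrank : 2 ≤ Module.finrank K H)
    (τ : L ≃ₗ⁅K⁆ L) (hτ : RootGraded.IsChevalleyInvolution H ℒ τ)
    (e : LieModule.Weight K H g → g) (he : RootGraded.IsChevalleyBasis e)
    (α : LieModule.Weight K H g) (hα : α ∈ H.root)
    (β γ δ : LieModule.Weight K H g) (hpair : RootGraded.IsA2Pair β γ)
    (hδ : (δ : H → K) = β + γ) :
    RootGraded.IsGradedAlgebra (RootGraded.coordinateMul e α β γ δ hδ)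
        (RootGraded.coordinateComponent ℒ α) ∧
      ∃ bar : RootGraded.component H (α : H → K) →ₗ[K] RootGraded.component H (α : H → K),
        RootGraded.IsPreChevalley (RootGraded.coordinateMul e α β γ δ hδ)
          (RootGraded.coordinateComponent ℒ α) bar := by
  exact proposition3p9_general g H ℒ hL.toIsRootLatticeGraded hlaced τ hτ e he.isRootVectorFamily
    α β γ δ (RootGraded.mem_root_iff.1 hα) (RootGraded.mem_root_iff.1 hpair.left_mem)
    (RootGraded.mem_root_iff.1 hpair.right_mem) (hpair.add_isNonZero hδ) hδ
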